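/- Let $(\Theta,g)$ and $(\Lambda,h)$ be compact connected smooth riemannian manifolds without boundary, let ${\bf E}$ be a finite-dimensional euclidean space, let $\iota:(\Theta,g)\to{\bf E}$ be a smooth isometric embedding and let $\gamma:(\Theta,g)\to(\Lambda,h)$ be a smooth riemannian immersion, i.e. $\gamma^*h=g$. For a smooth map $\phi$ between riemannian manifolds, $\nabla d\phi$ denotes its second fundamental form (the covariant derivative of the section $d\phi$ of $\mathrm{Hom}(TM,\phi^*TN)$), $\tau(\phi)=\sum_i\nabla d\phi(e_i,e_i)$ its tension field, and $\mathrm{Ric}^{d\phi}(x)=\sum_j (R_{x,e_j}d\phi)(e_j)$ with $R_{x,y}=\nabla^2_{x,y}-\nabla^2_{y,x}$, where $(e_i)$ is an orthonormal frame; all norms and inner products of tensors are the Hilbert--Schmidt ones. Let $\pi$ be the nearest-point projection of a neighbourhood of $\iota(\Theta)$ in ${\bf E}$ to $\Theta$, let $\Gamma=\gamma\circ\pi$, and define on $\Theta$ $$\kappa=\tfrac12|\nabla d\Gamma|^2-\tfrac23\langle d\Gamma,\mathrm{Ric}^{d\Gamma}\rangle+|\tau(\gamma)|^2+2\langle d\gamma,\nabla\tau(\gamma)\rangle,$$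 where the terms in $\Gamma$ are taken at the points of $\iota(\Theta)$. Let $\Delta_{\mathcal E}$ be the sub-laplacian of the sub-riemannian structure $E=(\ker d\gamma)^\perp$, $s=\gamma^*h|_E$, augmented with the riemannian volume of $g$; in local coordinates $$\Delta_{\mathcal E}u=-\frac1\rho\sum_{i,j}\partial_i\bigl(\rho\,\mu^{ij}\,\partial_j u\bigr),\qquad \rho=\sqrt{\det(g_{ij})},\qquad \mu(du,dv)=\langle d\gamma(\nabla u),d\gamma(\nabla v)\rangle .$$ Then: 1. $\Delta_{\mathcal E}u=\Delta u$ for every smooth $u:\Theta\to{\bf R}$, where $\Delta u=-\sum_i\nabla du(e_i,e_i)$ is the laplacian of $(\Theta,g)$. 2. $\kappa=\frac53|\nabla d\iota|^2-\frac23|\tau(\iota)|^2-\frac16|\nabla d\gamma|^2-\frac13|\tau(\gamma)|^2$ at every point of $\Theta$. 3. The following are equivalent: $\gamma$ is totally geodesic (it maps geodesics to geodesics); $\nabla d\gamma=0$; the immersed submanifold $\gamma(\Theta)$ of $\Lambda$ is totally geodesic (every geodesic of $\Lambda$ tangent to it at a point, namely with $c(0)=\gamma(\theta)$ and $c'(0)=d\gamma(v)$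 for some $v\in T_\theta\Theta$, stays for a short time in it, namely in $\gamma(U)$ for every neighbourhood $U$ of $\theta$). In this case $\kappa=\frac53|\nabla d\iota|^2-\frac23|\tau(\iota)|^2$. -/

import Mathlib

open Set Filter Topology Manifold
open scoped ContDiff

noncomputable section

/-! ### Riemannian geometry in coordinates

`V` and `W` are coordinate spaces.  A metric on (an open part of) `V` is a function
`G : V → V →L[ℝ] V →L[ℝ] ℝ`, and `G x u v` is the inner product at `x` of the coordinate
vectors `u`, `v`.  A map is given by its coordinate expression `f : V → W`. -/

namespace LocalGeometry

variable {V : Type*} [NormedAddCommGroup V] [NormedSpace ℝ V] [FiniteDimensional ℝ V]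
variable {W : Type*} [NormedAddCommGroup W] [NormedSpace ℝ W]

/-- The trace `∑ᵢⱼ Bⁱʲ T(bᵢ, bⱼ)` of a bilinear `T` with respect to an inner product `B`, with
`Bⁱʲ` the inverse Gram matrix of the basis `b`.  It equals `∑ᵢ T(eᵢ, eᵢ)` for every
`B`-orthonormal basis `e`: see `metricTrace_eq_sum`. -/
def metricTrace (B : V →L[ℝ] V →L[ℝ] ℝ) (T : V → V → W) : W :=
  ∑ i, T (Module.finBasis ℝ V i)
    (B.inverse (LinearMap.toContinuousLinearMap ((Module.finBasis ℝ V).coord i)))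

theorem metricTrace_eq_sum {ι : Type*} [Fintype ι] [DecidableEq ι]
    (B : V →L[ℝ] V →L[ℝ] ℝ) (T : V →ₗ[ℝ] V →ₗ[ℝ] W)
    (e : Module.Basis ι ℝ V) (he : ∀ i j, B (e i) (e j) = if i = j then 1 else 0) :
    metricTrace B (fun u v => T u v) = ∑ i, T (e i) (e i) := by
  have hB : ∀ (u : V) (j : ι), B u (e j) = e.repr u j := by
    intro u j
    conv_lhs => rw [← e.sum_repr u, map_sum, sum_apply]
    simp only [map_smul, smul_apply, smul_eq_mul, he]
    simp
  let S : (V →L[ℝ] ℝ) →L[ℝ] V := ∑ i, (ContinuousLinearMap.apply ℝ ℝ (e i)).smulRight (e i)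
  have hS : ∀ ξ, S ξ = ∑ i, ξ (e i) • e i := by
    intro ξ
    simp [S]
  have h1 : Function.LeftInverse S B := by
    intro u
    rw [hS]
    simp only [hB]
    exact e.sum_repr u
  have h2 : Function.RightInverse S B := by
    intro ξ
    have : ((B (S ξ) : V →L[ℝ] ℝ) : V →ₗ[ℝ] ℝ) = (ξ : V →ₗ[ℝ] ℝ) := by
      apply e.ext
      intro j
      simp [hS, he]
    ext v
    exact LinearMap.congr_fun this v
  have hinv : B.inverse = S := by
    have := ContinuousLinearMap.inverse_equiv (ContinuousLinearEquiv.equivOfInverse B S h1 h2)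
    exact this
  unfold metricTrace
  rw [hinv]
  simp only [hS, map_sum, map_smul, LinearMap.coe_toContinuousLinearMap']
  rw [Finset.sum_comm]
  refine Finset.sum_congr rfl fun j _ => ?_
  have h3 : T (e j) = ∑ i, (Module.finBasis ℝ V).repr (e j) i • T (Module.finBasis ℝ V i) := by
    conv_lhs => rw [← (Module.finBasis ℝ V).sum_repr (e j)]
    simp only [map_sum, map_smul]
  rw [h3, LinearMap.sum_apply]
  rfl

/-- The Christoffel symbols `Γ_x(u, v)` of the Levi-Civita connection of `G`, from the
Koszul formula `2 G(Γ(u, v), w) = DG(u)(v, w) + DG(v)(u, w) - DG(w)(u, v)`. -/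
def christoffel (G : V → V →L[ℝ] V →L[ℝ] ℝ) (x u v : V) : V :=
  (G x).inverse ((1 / 2 : ℝ) •
    (fderiv ℝ G x u v + fderiv ℝ G x v u - ((fderiv ℝ G x).flip u).flip v))

/-- The covariant derivative `∇_u s` of a section `s` of the pullback `f^*TW` of the tangent
bundle of `(W, H)`, with the pullback of the Levi-Civita connection of `H`. -/
def covDerivAlong (H : W → W →L[ℝ] W →L[ℝ] ℝ) (f : V → W) (s : V → W) (x u : V) : W :=
  fderiv ℝ s x u + christoffel H (f x) (fderiv ℝ f x u) (s x)

/-- The hessian (second fundamental form) `∇df(u, v) = (∇_u df)(v)` of a map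
`f : (V, G) → (W, H)`, i.e. the covariant derivative of the section `df` of
`Hom(TV, f^*TW)`. -/
def hess (G : V → V →L[ℝ] V →L[ℝ] ℝ) (H : W → W →L[ℝ] W →L[ℝ] ℝ) (f : V → W)
    (x u v : V) : W :=
  covDerivAlong H f (fun y => fderiv ℝ f y v) x u - fderiv ℝ f x (christoffel G x u v)

/-- The second covariant derivative `(∇²_{u,v} df)(w)`,
where `∇²_{u,v} = ∇_u ∇_v - ∇_{∇_u v}`. -/
def hess₂ (G : V → V →L[ℝ] V →L[ℝ] ℝ) (H : W → W →L[ℝ] W →L[ℝ] ℝ) (f : V → W)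
    (x u v w : V) : W :=
  covDerivAlong H f (fun y => hess G H f y v w) x u
    - hess G H f x (christoffel G x u v) w - hess G H f x v (christoffel G x u w)

/-- The curvature `(R_{u,v} df)(w)`, with `R_{u,v} = ∇²_{u,v} - ∇²_{v,u}`. -/
def curvature (G : V → V →L[ℝ] V →L[ℝ] ℝ) (H : W → W →L[ℝ] W →L[ℝ] ℝ) (f : V → W)
    (x u v w : V) : W :=
  hess₂ G H f x u v w - hess₂ G H f x v u w

/-- The Ricci tensor `Ric^{df}(u) = ∑ⱼ (R_{u,eⱼ} df)(eⱼ)`. -/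
def ricci (G : V → V →L[ℝ] V →L[ℝ] ℝ) (H : W → W →L[ℝ] W →L[ℝ] ℝ) (f : V → W)
    (x u : V) : W :=
  metricTrace (G x) (fun v w => curvature G H f x u v w)

/-- The tension field `τ(f) = ∑ᵢ ∇df(eᵢ, eᵢ)`. -/
def tension (G : V → V →L[ℝ] V →L[ℝ] ℝ) (H : W → W →L[ℝ] W →L[ℝ] ℝ) (f : V → W)
    (x : V) : W :=
  metricTrace (G x) (hess G H f x)

/-- `|∇df|² = ∑ᵢⱼ |∇df(eᵢ, eⱼ)|²`. -/
def normSqHess (G : V → V →L[ℝ] V →L[ℝ] ℝ) (H : W → W →L[ℝ] W →L[ℝ] ℝ) (f : V → W)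
    (x : V) : ℝ :=
  metricTrace (G x) (fun u u' => metricTrace (G x) (fun v v' =>
    H (f x) (hess G H f x u v) (hess G H f x u' v')))

/-- `|τ(f)|²`. -/
def normSqTension (G : V → V →L[ℝ] V →L[ℝ] ℝ) (H : W → W →L[ℝ] W →L[ℝ] ℝ) (f : V → W)
    (x : V) : ℝ :=
  H (f x) (tension G H f x) (tension G H f x)

/-- The inner product `⟨df, A⟩ = ∑ᵢ ⟨df(eᵢ), A(eᵢ)⟩` with `A ∈ Hom(T_xV, T_{f(x)}W)`. -/
def innerDiff (G : V → V →L[ℝ] V →L[ℝ] ℝ) (H : W → W →L[ℝ] W →L[ℝ] ℝ) (f : V → W)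
    (x : V) (A : V → W) : ℝ :=
  metricTrace (G x) (fun u u' => H (f x) (fderiv ℝ f x u) (A u'))

/-- The bundle map `μ : T^*V → TV` of the sub-riemannian structure induced by `f`:
`μ(du) = df' (df (∇u))`, with `df'` the transpose of `df`. Thus
`μ(du, dv) = ⟨df(∇u), df(∇v)⟩` and the image of `μ` is `(ker df)^⊥`. -/
def subCometric (G : V → V →L[ℝ] V →L[ℝ] ℝ) (H : W → W →L[ℝ] W →L[ℝ] ℝ) (f : V → W)
    (x : V) (ξ : V →L[ℝ] ℝ) : V :=
  (G x).inverse ((H (f x) (fderiv ℝ f x ((G x).inverse ξ))).comp (fderiv ℝ f x))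

/-- The density `√det(Gᵢⱼ)` of the riemannian volume. -/
def volDensity (G : V → V →L[ℝ] V →L[ℝ] ℝ) (x : V) : ℝ :=
  √(Matrix.det (Matrix.of fun i j =>
    G x (Module.finBasis ℝ V i) (Module.finBasis ℝ V j)))

/-- The sub-laplacian `- ρ⁻¹ ∑ᵢⱼ ∂ᵢ (ρ μⁱʲ ∂ⱼ u)` of the sub-riemannian structure induced by `f`
augmented with the riemannian volume of `G`, whose density is `ρ`. -/
def subLaplacian (G : V → V →L[ℝ] V →L[ℝ] ℝ) (H : W → W →L[ℝ] W →L[ℝ] ℝ) (f : V → W)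
    (u : V → ℝ) (x : V) : ℝ :=
  -((volDensity G x)⁻¹ * LinearMap.trace ℝ V
    (fderiv ℝ (fun y => volDensity G y • subCometric G H f y (fderiv ℝ u y)) x : V →L[ℝ] V))

end LocalGeometry

/-! ### Riemannian manifolds

`M` is a manifold modelled on the finite-dimensional space `V`, with a smooth riemannian
metric `g`.  The tensors of a map at a point are computed in the preferred charts at the point
and at its image, the charts through which `TangentSpace` is identified with the model space. -/

section Manifold

variable {V : Type*} [NormedAddCommGroup V] [NormedSpace ℝ V] [FiniteDimensional ℝ V]
variable {M : Type*} [TopologicalSpace M] [ChartedSpace V M] [IsManifold 𝓘(ℝ, V) ∞ M]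
variable {W : Type*} [NormedAddCommGroup W] [NormedSpace ℝ W] [FiniteDimensional ℝ W]
variable {N : Type*} [TopologicalSpace N] [ChartedSpace W N] [IsManifold 𝓘(ℝ, W) ∞ N]

variable (V M) in
/-- Smooth riemannian metrics on `M`. -/
abbrev SmoothMetric : Type _ :=
  Bundle.ContMDiffRiemannianMetric 𝓘(ℝ, V) ∞ V (fun x : M => TangentSpace 𝓘(ℝ, V) x)

/-- The constant metric of a euclidean space. -/
def euclideanMetric (F : Type*) [NormedAddCommGroup F] [InnerProductSpace ℝ F] :
    SmoothMetric F F where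
  inner := (riemannianMetricVectorSpace F).inner
  symm := (riemannianMetricVectorSpace F).symm
  pos := (riemannianMetricVectorSpace F).pos
  isVonNBounded := (riemannianMetricVectorSpace F).isVonNBounded
  contMDiff := (riemannianMetricVectorSpace F).contMDiff.of_le le_top

/-- The metric `g` in the coordinates of the preferred chart at `p`. -/
def localMetric (g : SmoothMetric V M) (p : M) (x : V) : V →L[ℝ] V →L[ℝ] ℝ :=
  let B : V →L[ℝ] V →L[ℝ] ℝ := g.inner ((chartAt V p).symm x)
  let A : V →L[ℝ] V := mfderiv 𝓘(ℝ, V) 𝓘(ℝ, V) (chartAt V p).symm x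
  B.bilinearComp A A

/-- The map `φ` in the coordinates of the preferred charts at `p` and `φ p`. -/
def localMap (φ : M → N) (p : M) (x : V) : W :=
  chartAt W (φ p) (φ ((chartAt V p).symm x))

/-- The second fundamental form `∇dφ` at `p`. -/
def secondFundamentalForm (g : SmoothMetric V M) (h : SmoothMetric W N) (φ : M → N) (p : M)
    (u v : TangentSpace 𝓘(ℝ, V) p) : TangentSpace 𝓘(ℝ, W) (φ p) :=
  LocalGeometry.hess (V := V) (W := W) (localMetric g p) (localMetric h (φ p)) (localMap φ p)
    (chartAt V p p) u v

/-- The tension field `τ(φ)` at `p`. -/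
def tensionField (g : SmoothMetric V M) (h : SmoothMetric W N) (φ : M → N) (p : M) :
    TangentSpace 𝓘(ℝ, W) (φ p) :=
  LocalGeometry.tension (V := V) (W := W) (localMetric g p) (localMetric h (φ p))
    (localMap φ p) (chartAt V p p)

/-- `|∇dφ|²` at `p`. -/
def normSqSecondFundamentalForm (g : SmoothMetric V M) (h : SmoothMetric W N) (φ : M → N)
    (p : M) : ℝ :=
  LocalGeometry.normSqHess (localMetric g p) (localMetric h (φ p)) (localMap φ p)
    (chartAt V p p)

/-- `|τ(φ)|²` at `p`. -/
def normSqTensionField (g : SmoothMetric V M) (h : SmoothMetric W N) (φ : M → N)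
    (p : M) : ℝ :=
  LocalGeometry.normSqTension (localMetric g p) (localMetric h (φ p)) (localMap φ p)
    (chartAt V p p)

/-- `⟨dφ, Ric^{dφ}⟩` at `p`. -/
def innerDiffRicci (g : SmoothMetric V M) (h : SmoothMetric W N) (φ : M → N) (p : M) : ℝ :=
  LocalGeometry.innerDiff (localMetric g p) (localMetric h (φ p)) (localMap φ p) (chartAt V p p)
    (LocalGeometry.ricci (localMetric g p) (localMetric h (φ p)) (localMap φ p) (chartAt V p p))

/-- `⟨dφ, ∇τ(φ)⟩` at `p`. -/
def innerDiffNablaTension (g : SmoothMetric V M) (h : SmoothMetric W N) (φ : M → N)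
    (p : M) : ℝ :=
  LocalGeometry.innerDiff (localMetric g p) (localMetric h (φ p)) (localMap φ p) (chartAt V p p)
    (LocalGeometry.covDerivAlong (localMetric h (φ p)) (localMap φ p)
      (LocalGeometry.tension (localMetric g p) (localMetric h (φ p)) (localMap φ p))
      (chartAt V p p))

/-- The laplacian `Δu = d^*du = -∑ᵢ ∇du(eᵢ, eᵢ)` of `(M, g)` (a nonnegative operator). -/
def laplacian (g : SmoothMetric V M) (u : M → ℝ) (p : M) : ℝ :=
  -(tensionField g (euclideanMetric ℝ) u p : ℝ)

/-- The sub-laplacian, on functions on `M`, of the sub-riemannian structure `(E, s)`,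
`E = (ker dφ)^⊥` and `s = φ^*h | E`, augmented with the riemannian volume of `g`. -/
def subLaplacian (g : SmoothMetric V M) (h : SmoothMetric W N) (φ : M → N) (u : M → ℝ)
    (p : M) : ℝ :=
  LocalGeometry.subLaplacian (localMetric g p) (localMetric h (φ p)) (localMap φ p)
    (u ∘ (chartAt V p).symm) (chartAt V p p)

/-- Riemannian immersions: smooth maps with `φ^*h = g`. -/
def IsRiemannianImmersion (g : SmoothMetric V M) (h : SmoothMetric W N) (φ : M → N) : Prop :=
  ContMDiff 𝓘(ℝ, V) 𝓘(ℝ, W) ∞ φ ∧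
    ∀ (p : M) (u v : TangentSpace 𝓘(ℝ, V) p),
      h.inner (φ p) (mfderiv 𝓘(ℝ, V) 𝓘(ℝ, W) φ p u) (mfderiv 𝓘(ℝ, V) 𝓘(ℝ, W) φ p v) =
        g.inner p u v

/-- `c` is a geodesic on the open interval `(a, b)`: a `C²` (hence smooth) curve with
`∇_{c'} c' = ∇dc(∂_t, ∂_t) = 0`. -/
def IsGeodesicOn (g : SmoothMetric V M) (c : ℝ → M) (a b : ℝ) : Prop :=
  ContMDiffOn 𝓘(ℝ, ℝ) 𝓘(ℝ, V) 2 c (Ioo a b) ∧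
    ∀ t ∈ Ioo a b, secondFundamentalForm (euclideanMetric ℝ) g c t (1 : ℝ) (1 : ℝ) = 0

/-- `φ` is totally geodesic: it maps geodesics to geodesics. -/
def IsTotallyGeodesic (g : SmoothMetric V M) (h : SmoothMetric W N) (φ : M → N) : Prop :=
  ∀ (c : ℝ → M) (a b : ℝ), IsGeodesicOn g c a b → IsGeodesicOn h (φ ∘ c) a b

/-- The immersed submanifold `φ(M)` of `(N, h)` is totally geodesic: a geodesic of `(N, h)`
that is tangent to it at `φ(p)` stays in it, more precisely in the sheet `φ(U)` of any
neighbourhood `U` of `p`, for a short time. -/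
def HasTotallyGeodesicImage (h : SmoothMetric W N) (φ : M → N) : Prop :=
  ∀ (p : M) (v : TangentSpace 𝓘(ℝ, V) p) (c : ℝ → N) (a b : ℝ), a < 0 → 0 < b →
    IsGeodesicOn h c a b → c 0 = φ p →
    (mfderiv 𝓘(ℝ, ℝ) 𝓘(ℝ, W) c 0 (1 : ℝ) : W) = (mfderiv 𝓘(ℝ, V) 𝓘(ℝ, W) φ p v : W) →
    ∀ U ∈ 𝓝 p, ∀ᶠ t in 𝓝 (0 : ℝ), c t ∈ φ '' U

/-- The orthogonal projection `π` onto `ι(M)`: `π(x)` is a point `p` for which `ι(p)` is nearest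
to `x`.  When `M` is compact and `ι` is an embedding, it is unique for `x` near `ι(M)`, and `π`
is there the projection `ι(p) + n ↦ p` of the normal bundle, `n ⟂ T_pM`. -/
def nearestPoint [Nonempty M] {F : Type*} [NormedAddCommGroup F] (ι : M → F) (x : F) : M :=
  Classical.epsilon fun p => ∀ q, ‖x - ι p‖ ≤ ‖x - ι q‖

/-- The curvature term
`κ = ½ |∇dΓ|² - ⅔ ⟨dΓ, Ric^{dΓ}⟩ + |τ(γ)|² + 2 ⟨dγ, ∇τ(γ)⟩` at a point of `M`, where `Γ = γ ∘ π`
is defined near `ι(M)` in the euclidean space `F`. -/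
def curvatureTerm [Nonempty M] {F : Type*} [NormedAddCommGroup F] [InnerProductSpace ℝ F]
    [FiniteDimensional ℝ F] (g : SmoothMetric V M) (h : SmoothMetric W N) (ι : M → F)
    (γ : M → N) (p : M) : ℝ :=
  1 / 2 * normSqSecondFundamentalForm (euclideanMetric F) h (γ ∘ nearestPoint ι) (ι p)
    - 2 / 3 * innerDiffRicci (euclideanMetric F) h (γ ∘ nearestPoint ι) (ι p)
    + normSqTensionField g h γ p + 2 * innerDiffNablaTension g h γ p

end Manifold

end

/-! Everything is computed in charts, where a riemannian immersion becomes a map `f` between open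
pieces of vector spaces satisfying `H(df u, df v) = G(u, v)`. Three classical facts carry the
argument. The form `∇df` is normal (`IsIsometricAt.hess_normal`). A normal section `s` satisfies the
Weingarten identity `⟨∇_u s, df w⟩ = -⟨s, ∇df(u, w)⟩` (`IsIsometricAt.inner_covDerivAlong_eq`).
Together they give the Gauss equation and its trace (`IsIsometricAt.sum_inner_riemann`).

Sub-laplacian: since `dγ` preserves inner products, `μ` is the inverse metric. What remains is the
coordinate divergence formula for the Laplace-Beltrami operator, that is, the identity between the
logarithmic derivative of the density and a trace of Christoffel symbols
(`IsIsometricAt.subLaplacian_eq`).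

Formula for `κ`: as `∇dγ` is normal, the two terms of `∇dΓ = ∇dγ(dπ, dπ) + dγ(∇dπ)` are orthogonal.
Differentiating `⟨y - ι(π y), dι v⟩ = 0` twice on `ι(Θ)` expresses `∇dπ` through `∇dι`
(`IsProjectionAt.inner_hess`): it vanishes on tangent-tangent and normal-normal pairs, and each of
the two mixed blocks has square norm `|∇dι|²`. Hence `|∇dΓ|² = |∇dγ|² + 2|∇dι|²`. The euclidean
domain is flat and `dΓ` kills normal vectors, so `⟨dΓ, Ric^{dΓ}⟩` is the trace of the curvature of
`Λ` along `γ`. By Gauss for `γ` this is `scal + |∇dγ|² - |τ(γ)|²`, and by Gauss for `ι` one has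
`scal = |τ(ι)|² - |∇dι|²`. Finally `τ(γ)` is normal, so `⟨dγ, ∇τ(γ)⟩ = -|τ(γ)|²`. Adding up gives
the coefficients.

Total geodesy: along a geodesic `c` the acceleration of `γ ∘ c` is `∇dγ(c', c')`, and polarisation
yields the first equivalence. If `γ` is totally geodesic, uniqueness of geodesics identifies a
tangent geodesic of `Λ` with the image of one of `Θ`. Conversely, a geodesic of `Λ` lying in a sheet
of `γ` is pulled back by a local left inverse of `γ`; its vanishing acceleration splits into a
normal part `∇dγ(c', c')` and a tangential part, and both are zero. -/

set_option maxSynthPendingDepth 3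
set_option linter.unusedSectionVars false

/-! ### Inner products, orthonormal bases and traces. -/

namespace LocalGeometry

variable {V : Type*} [NormedAddCommGroup V] [NormedSpace ℝ V] [FiniteDimensional ℝ V]
variable {W : Type*} [NormedAddCommGroup W] [NormedSpace ℝ W] [FiniteDimensional ℝ W]

/-- `B` is an inner product. -/
structure IsInner (B : V →L[ℝ] V →L[ℝ] ℝ) : Prop where
  symm : ∀ u v, B u v = B v u
  pos : ∀ u, u ≠ 0 → 0 < B u u

namespace IsInner

variable {B : V →L[ℝ] V →L[ℝ] ℝ}

theorem nonneg (hB : IsInner B) (u : V) : 0 ≤ B u u := by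
  by_cases hu : u = 0
  · simp [hu]
  · exact (hB.pos u hu).le

theorem eq_zero (hB : IsInner B) {u : V} (hu : B u u = 0) : u = 0 := by
  by_contra h
  exact (hB.pos u h).ne' hu

theorem eq_zero_of_forall (hB : IsInner B) {u : V} (hu : ∀ v, B u v = 0) : u = 0 :=
  hB.eq_zero (hu u)

theorem ext (hB : IsInner B) {u v : V} (h : ∀ w, B u w = B v w) : u = v := by
  refine sub_eq_zero.mp (hB.eq_zero_of_forall fun w => ?_)
  simp [h w]

/-- Stated for a space without topology, so that the norm built from `c` does not compete with a
norm already present on `V`. -/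
theorem exists_basis_aux {E : Type*} [AddCommGroup E] [Module ℝ E] [FiniteDimensional ℝ E]
    (c : InnerProductSpace.Core ℝ E) :
    ∃ e : Module.Basis (Fin (Module.finrank ℝ E)) ℝ E,
      ∀ i j, c.inner (e i) (e j) = if i = j then 1 else 0 := by
  let _ : NormedAddCommGroup E := c.toNormedAddCommGroup
  let _ : InnerProductSpace ℝ E := InnerProductSpace.ofCore c.toCore
  refine ⟨(stdOrthonormalBasis ℝ E).toBasis, fun i j => ?_⟩
  have := orthonormal_iff_ite.mp (stdOrthonormalBasis ℝ E).orthonormal i j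
  simpa using this

theorem exists_basis (hB : IsInner B) :
    ∃ e : Module.Basis (Fin (Module.finrank ℝ V)) ℝ V,
      ∀ i j, B (e i) (e j) = if i = j then 1 else 0 := by
  let c : InnerProductSpace.Core ℝ V :=
    { inner := fun u v => B u v
      conj_inner_symm := fun u v => by simp [hB.symm u v]
      re_inner_nonneg := fun u => by simpa using hB.nonneg u
      add_left := fun u v w => by simp
      smul_left := fun u v r => by simp
      definite := fun u hu => hB.eq_zero hu }
  exact exists_basis_aux c

/-- A definite form is injective into the dual, which has the same dimension. Without this,
`B.inverse` would take its default value `0`. -/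
theorem isInvertible (hB : IsInner B) : B.IsInvertible := by
  have hinj : Function.Injective (B : V →ₗ[ℝ] (V →L[ℝ] ℝ)) := by
    intro u v h
    exact hB.ext fun w => DFunLike.congr_fun h w
  have hdim : Module.finrank ℝ V = Module.finrank ℝ (V →L[ℝ] ℝ) := by
    rw [← (LinearMap.toContinuousLinearMap : (V →ₗ[ℝ] ℝ) ≃ₗ[ℝ] (V →L[ℝ] ℝ)).finrank_eq]
    exact (Subspace.dual_finrank_eq (K := ℝ) (V := V)).symm
  refine ⟨(LinearEquiv.ofInjectiveOfFinrankEq (B : V →ₗ[ℝ] (V →L[ℝ] ℝ)) hinj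
    hdim).toContinuousLinearEquiv, ?_⟩
  ext u v
  rfl

theorem apply_inverse (hB : IsInner B) (ξ : V →L[ℝ] ℝ) : B (B.inverse ξ) = ξ := by
  obtain ⟨e, he⟩ := hB.isInvertible
  rw [← he]
  simp

theorem repr_eq {n : Type*} [Fintype n] [DecidableEq n] {e : Module.Basis n ℝ V}
    (he : ∀ i j, B (e i) (e j) = if i = j then 1 else 0) (u : V) (j : n) :
    e.repr u j = B u (e j) := by
  conv_rhs => rw [← e.sum_repr u, map_sum, sum_apply]
  simp [he]

end IsInner

theorem metricTrace_eq_sum' {n : Type*} [Fintype n] [DecidableEq n] {B : V →L[ℝ] V →L[ℝ] ℝ}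
    {e : Module.Basis n ℝ V} (he : ∀ i j, B (e i) (e j) = if i = j then 1 else 0)
    {T : V → V → W} (T' : V →L[ℝ] V →L[ℝ] W) (hT : ∀ u v, T u v = T' u v) :
    metricTrace B T = ∑ i, T (e i) (e i) := by
  have h := metricTrace_eq_sum B
    ((ContinuousLinearMap.coeLM ℝ : (V →L[ℝ] W) →ₗ[ℝ] V →ₗ[ℝ] W) ∘ₗ (T' : V →ₗ[ℝ] V →L[ℝ] W)) e he
  simp only [LinearMap.comp_apply, ContinuousLinearMap.coe_coe,
    ContinuousLinearMap.coeLM_apply] at h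
  have : T = fun u v => T' u v := by
    ext u v
    exact hT u v
  subst this
  exact h

/-! ### The Levi-Civita connection in coordinates. -/

/-- `G` is a riemannian metric of class `C²` near `x`. -/
structure IsMetricAt (G : V → V →L[ℝ] V →L[ℝ] ℝ) (x : V) : Prop where
  contDiffAt : ContDiffAt ℝ 2 G x
  inner : ∀ᶠ y in 𝓝 x, IsInner (G y)

theorem IsMetricAt.isInner {G : V → V →L[ℝ] V →L[ℝ] ℝ} {x : V} (h : IsMetricAt G x) :
    IsInner (G x) := h.inner.self_of_nhds

theorem IsMetricAt.eventually {G : V → V →L[ℝ] V →L[ℝ] ℝ} {x : V} (h : IsMetricAt G x) :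
    ∀ᶠ y in 𝓝 x, IsMetricAt G y := by
  filter_upwards [h.contDiffAt.eventually (by simp), h.inner.eventually_nhds] with y h1 h2
  exact ⟨h1, h2⟩

theorem IsMetricAt.differentiableAt {G : V → V →L[ℝ] V →L[ℝ] ℝ} {x : V} (h : IsMetricAt G x) :
    DifferentiableAt ℝ G x := h.contDiffAt.differentiableAt (by norm_num)

/-- The right hand side of the Koszul formula, as a function of the derivative of the metric. -/
noncomputable def koszul : (V →L[ℝ] V →L[ℝ] V →L[ℝ] ℝ) →L[ℝ] (V →L[ℝ] V →L[ℝ] V →L[ℝ] ℝ) :=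
  (1 / 2 : ℝ) • (ContinuousLinearMap.id ℝ _
    + ((ContinuousLinearMap.flipₗᵢ ℝ V V (V →L[ℝ] ℝ)).toContinuousLinearEquiv :
        (V →L[ℝ] V →L[ℝ] V →L[ℝ] ℝ) →L[ℝ] (V →L[ℝ] V →L[ℝ] V →L[ℝ] ℝ))
    - (ContinuousLinearMap.compL ℝ V (V →L[ℝ] V →L[ℝ] ℝ) (V →L[ℝ] V →L[ℝ] ℝ)
        ((ContinuousLinearMap.flipₗᵢ ℝ V V ℝ).toContinuousLinearEquiv :
          (V →L[ℝ] V →L[ℝ] ℝ) →L[ℝ] (V →L[ℝ] V →L[ℝ] ℝ))).comp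
      ((ContinuousLinearMap.flipₗᵢ ℝ V V (V →L[ℝ] ℝ)).toContinuousLinearEquiv :
        (V →L[ℝ] V →L[ℝ] V →L[ℝ] ℝ) →L[ℝ] (V →L[ℝ] V →L[ℝ] V →L[ℝ] ℝ)))

theorem koszul_apply (D : V →L[ℝ] V →L[ℝ] V →L[ℝ] ℝ) (u v w : V) :
    koszul D u v w = (1 / 2) * (D u v w + D v u w - D w u v) := by
  simp [koszul]

/-- The Christoffel symbols as a continuous bilinear map. -/
noncomputable def christoffelCLM (G : V → V →L[ℝ] V →L[ℝ] ℝ) (x : V) : V →L[ℝ] V →L[ℝ] V :=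
  (ContinuousLinearMap.compL ℝ V (V →L[ℝ] ℝ) V (G x).inverse).comp (koszul (fderiv ℝ G x))

theorem christoffel_eq (G : V → V →L[ℝ] V →L[ℝ] ℝ) (x u v : V) :
    christoffel G x u v = christoffelCLM G x u v := by
  simp only [christoffel, christoffelCLM, ContinuousLinearMap.comp_apply,
    ContinuousLinearMap.compL_apply]
  congr 1

/-- One derivative is lost. Class `C¹` suffices both for the curvature, which differentiates the
symbols once, and for the existence and uniqueness of geodesics. -/
theorem contDiffAt_christoffelCLM {G : V → V →L[ℝ] V →L[ℝ] ℝ} {x : V} (h : IsMetricAt G x) :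
    ContDiffAt ℝ 1 (christoffelCLM G) x := by
  have := FiniteDimensional.complete ℝ V
  have h1 : ContDiffAt ℝ 1 (fun y => (G y).inverse) x :=
    (h.isInner.isInvertible.contDiffAt_map_inverse).comp x (h.contDiffAt.of_le (by norm_num))
  have h2 : ContDiffAt ℝ 1 (fun y => koszul (fderiv ℝ G y)) x :=
    koszul.contDiff.contDiffAt.comp x (h.contDiffAt.fderiv_right (by norm_num))
  exact ((ContinuousLinearMap.contDiff _).contDiffAt.comp x h1).clm_comp h2

/-- Pairing with `w` removes the inverse metric; identities for the connection are checked in this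
form. -/
theorem apply_christoffel {G : V → V →L[ℝ] V →L[ℝ] ℝ} {x : V} (h : IsInner (G x)) (u v w : V) :
    G x (christoffelCLM G x u v) w =
      (1 / 2) * (fderiv ℝ G x u v w + fderiv ℝ G x v u w - fderiv ℝ G x w u v) := by
  simp only [christoffelCLM, ContinuousLinearMap.comp_apply, ContinuousLinearMap.compL_apply]
  rw [h.apply_inverse, koszul_apply]

theorem IsMetricAt.fderiv_symm {G : V → V →L[ℝ] V →L[ℝ] ℝ} {x : V} (h : IsMetricAt G x)
    (u v w : V) : fderiv ℝ G x u v w = fderiv ℝ G x u w v := by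
  have hG := h.differentiableAt.hasFDerivAt
  have key : ∀ v w : V, HasFDerivAt (fun y => G y v w)
      (((ContinuousLinearMap.apply ℝ ℝ w).comp (ContinuousLinearMap.apply ℝ _ v)).comp
        (fderiv ℝ G x)) x := fun v w =>
    ((ContinuousLinearMap.apply ℝ ℝ w).comp (ContinuousLinearMap.apply ℝ _ v)).hasFDerivAt.comp x hG
  have h2 : (fun y => G y w v) =ᶠ[𝓝 x] fun y => G y v w := by
    filter_upwards [h.inner] with y hy using hy.symm _ _
  have := ((key v w).congr_of_eventuallyEq h2).unique (key w v)
  simpa using DFunLike.congr_fun this u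

theorem IsMetricAt.christoffel_symm {G : V → V →L[ℝ] V →L[ℝ] ℝ} {x : V} (h : IsMetricAt G x)
    (u v : V) : christoffelCLM G x u v = christoffelCLM G x v u := by
  refine h.isInner.ext fun w => ?_
  rw [apply_christoffel h.isInner, apply_christoffel h.isInner, h.fderiv_symm w u v]
  ring

/-- The Levi-Civita connection is compatible with the metric. -/
theorem IsMetricAt.fderiv_eq {G : V → V →L[ℝ] V →L[ℝ] ℝ} {x : V} (h : IsMetricAt G x)
    (u v w : V) : fderiv ℝ G x u v w =
      G x (christoffelCLM G x u v) w + G x v (christoffelCLM G x u w) := by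
  rw [h.isInner.symm v, apply_christoffel h.isInner, apply_christoffel h.isInner,
    h.fderiv_symm u w v]
  ring

/-! ### Second fundamental form and curvature of a map. -/

/-- The second fundamental form as a continuous bilinear map. -/
noncomputable def hessCLM (G : V → V →L[ℝ] V →L[ℝ] ℝ) (H : W → W →L[ℝ] W →L[ℝ] ℝ) (f : V → W)
    (x : V) : V →L[ℝ] V →L[ℝ] W :=
  fderiv ℝ (fderiv ℝ f) x
    + (((christoffelCLM H (f x)).comp (fderiv ℝ f x)).flip.comp (fderiv ℝ f x)).flip
    - (ContinuousLinearMap.compL ℝ V V W (fderiv ℝ f x)).comp (christoffelCLM G x)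

section

variable {G : V → V →L[ℝ] V →L[ℝ] ℝ} {H : W → W →L[ℝ] W →L[ℝ] ℝ} {f : V → W} {x : V}

theorem hessCLM_apply (u v : V) :
    hessCLM G H f x u v = fderiv ℝ (fderiv ℝ f) x u v
      + christoffelCLM H (f x) (fderiv ℝ f x u) (fderiv ℝ f x v)
      - fderiv ℝ f x (christoffelCLM G x u v) := by
  simp [hessCLM]

theorem differentiableAt_fderiv (hf : ContDiffAt ℝ 2 f x) : DifferentiableAt ℝ (fderiv ℝ f) x :=
  (hf.fderiv_right (m := 1) (by norm_num)).differentiableAt (by norm_num)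

theorem fderiv_fderiv_apply (hf : ContDiffAt ℝ 2 f x) (u v : V) :
    fderiv ℝ (fun y => fderiv ℝ f y v) x u = fderiv ℝ (fderiv ℝ f) x u v := by
  rw [fderiv_clm_apply (differentiableAt_fderiv hf) (differentiableAt_const v)]
  simp

theorem hess_eq (hf : ContDiffAt ℝ 2 f x) (u v : V) :
    hess G H f x u v = hessCLM G H f x u v := by
  rw [hessCLM_apply, hess, covDerivAlong, fderiv_fderiv_apply hf, christoffel_eq, christoffel_eq]

theorem eventually_hess_eq (hf : ContDiffAt ℝ 2 f x) :
    ∀ᶠ y in 𝓝 x, ∀ u v, hess G H f y u v = hessCLM G H f y u v := by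
  filter_upwards [hf.eventually (by simp)] with y hy u v using hess_eq hy u v

/-- The constant coordinate field `v` is not parallel; the last term is `df(∇_u v)`. -/
theorem covDerivAlong_fderiv (u v : V) :
    covDerivAlong H f (fun y => fderiv ℝ f y v) x u =
      hess G H f x u v + fderiv ℝ f x (christoffelCLM G x u v) := by
  rw [hess, christoffel_eq]
  abel

theorem contDiffAt_hessCLM (hG : IsMetricAt G x) (hH : IsMetricAt H (f x))
    (hf : ContDiffAt ℝ 3 f x) : ContDiffAt ℝ 1 (hessCLM G H f) x := by
  have h1 : ContDiffAt ℝ 2 (fderiv ℝ f) x := hf.fderiv_right (by norm_num)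
  have h2 : ContDiffAt ℝ 1 (fderiv ℝ (fderiv ℝ f)) x := h1.fderiv_right (by norm_num)
  have h1' : ContDiffAt ℝ 1 (fderiv ℝ f) x := h1.of_le (by norm_num)
  have hC : ContDiffAt ℝ 1 (fun y => christoffelCLM H (f y)) x :=
    (contDiffAt_christoffelCLM hH).comp x (hf.of_le (by norm_num))
  have hflip : ContDiffAt ℝ 1 (fun y => ((christoffelCLM H (f y)).comp (fderiv ℝ f y)).flip) x :=
    (ContinuousLinearMap.flipₗᵢ ℝ V W W).toContinuousLinearEquiv.contDiff.contDiffAt.comp x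
      (hC.clm_comp h1')
  have hflip2 : ContDiffAt ℝ 1 (fun y =>
      (((christoffelCLM H (f y)).comp (fderiv ℝ f y)).flip.comp (fderiv ℝ f y)).flip) x :=
    (ContinuousLinearMap.flipₗᵢ ℝ V V W).toContinuousLinearEquiv.contDiff.contDiffAt.comp x
      (hflip.clm_comp h1')
  have hL : ContDiffAt ℝ 1 (fun y => (ContinuousLinearMap.compL ℝ V V W (fderiv ℝ f y))) x :=
    (ContinuousLinearMap.contDiff _).contDiffAt.comp x h1'
  exact (h2.add hflip2).sub (hL.clm_comp (contDiffAt_christoffelCLM hG))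

/-- Both connections are torsion free, and the second derivative is symmetric. -/
theorem hessCLM_symm (hG : IsMetricAt G x) (hH : IsMetricAt H (f x)) (hf : ContDiffAt ℝ 2 f x)
    (u v : V) : hessCLM G H f x u v = hessCLM G H f x v u := by
  rw [hessCLM_apply, hessCLM_apply, hG.christoffel_symm u v, hH.christoffel_symm]
  congr 2
  exact (hf.isSymmSndFDerivAt (by simp)) u v

/-- The derivative of the components of the second fundamental form. -/
theorem fderiv_hess_apply (hG : IsMetricAt G x) (hH : IsMetricAt H (f x))
    (hf : ContDiffAt ℝ 3 f x) (u v w : V) :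
    fderiv ℝ (fun y => hess G H f y v w) x u =
      fderiv ℝ (fderiv ℝ (fderiv ℝ f)) x u v w
      + fderiv ℝ (christoffelCLM H) (f x) (fderiv ℝ f x u) (fderiv ℝ f x v) (fderiv ℝ f x w)
      + christoffelCLM H (f x) (fderiv ℝ (fderiv ℝ f) x u v) (fderiv ℝ f x w)
      + christoffelCLM H (f x) (fderiv ℝ f x v) (fderiv ℝ (fderiv ℝ f) x u w)
      - fderiv ℝ (fderiv ℝ f) x u (christoffelCLM G x v w)
      - fderiv ℝ f x (fderiv ℝ (christoffelCLM G) x u v w) := by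
  have h2 : ContDiffAt ℝ 2 f x := hf.of_le (by norm_num)
  have e : (fun y => hess G H f y v w) =ᶠ[𝓝 x] fun y =>
      fderiv ℝ (fderiv ℝ f) y v w
      + christoffelCLM H (f y) (fderiv ℝ f y v) (fderiv ℝ f y w)
      - fderiv ℝ f y (christoffelCLM G y v w) := by
    filter_upwards [eventually_hess_eq (G := G) (H := H) h2] with y hy
    rw [hy, hessCLM_apply]
  rw [e.fderiv_eq]
  have d0 : HasFDerivAt f (fderiv ℝ f x) x := (h2.differentiableAt (by norm_num)).hasFDerivAt
  have d1 := (differentiableAt_fderiv h2).hasFDerivAt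
  have d2 := (differentiableAt_fderiv (hf.fderiv_right (m := 2) (by norm_num))).hasFDerivAt
  have dG := ((contDiffAt_christoffelCLM hG).differentiableAt (by norm_num)).hasFDerivAt
  have dH := ((contDiffAt_christoffelCLM hH).differentiableAt (by norm_num)).hasFDerivAt.comp x d0
  have c (w : V) := hasFDerivAt_const (𝕜 := ℝ) w x
  have k1 := (d2.clm_apply (c v)).clm_apply (c w)
  have k2 := (dH.clm_apply (d1.clm_apply (c v))).clm_apply (d1.clm_apply (c w))
  have k3 := d1.clm_apply ((dG.clm_apply (c v)).clm_apply (c w))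
  have := ((k1.add k2).sub k3).fderiv
  rw [show (fun y => fderiv ℝ (fderiv ℝ f) y v w
      + christoffelCLM H (f y) (fderiv ℝ f y v) (fderiv ℝ f y w)
      - fderiv ℝ f y (christoffelCLM G y v w)) = _ from rfl]
  refine (DFunLike.congr_fun this u).trans ?_
  simp
  abel

/-- The Riemann curvature tensor `R(a, b)c` of `H` at `y`. -/
noncomputable def riemann (H : W → W →L[ℝ] W →L[ℝ] ℝ) (y a b c : W) : W :=
  fderiv ℝ (christoffelCLM H) y a b c - fderiv ℝ (christoffelCLM H) y b a c
    + christoffelCLM H y a (christoffelCLM H y b c) - christoffelCLM H y b (christoffelCLM H y a c)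

/-- Antisymmetrisation in `u`, `v` cancels the third derivative of `f` and all terms in its second
derivative. What survives is the curvature of `Hom(TV, f^*TW)` acting on `df`. -/
theorem curvature_eq (hG : IsMetricAt G x) (hH : IsMetricAt H (f x))
    (hf : ContDiffAt ℝ 3 f x) (u v w : V) :
    curvature G H f x u v w =
      riemann H (f x) (fderiv ℝ f x u) (fderiv ℝ f x v) (fderiv ℝ f x w)
        - fderiv ℝ f x (riemann G x u v w) := by
  have h2 : ContDiffAt ℝ 2 f x := hf.of_le (by norm_num)
  have s3 : fderiv ℝ (fderiv ℝ (fderiv ℝ f)) x u v = fderiv ℝ (fderiv ℝ (fderiv ℝ f)) x v u :=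
    ((hf.fderiv_right (m := 2) (by norm_num)).isSymmSndFDerivAt (by simp)) u v
  have s2 : fderiv ℝ (fderiv ℝ f) x u v = fderiv ℝ (fderiv ℝ f) x v u :=
    (h2.isSymmSndFDerivAt (by simp)) u v
  simp only [curvature, hess₂, covDerivAlong, fderiv_hess_apply hG hH hf, christoffel_eq,
    hess_eq h2, hessCLM_apply, riemann, hG.christoffel_symm v u, s3, s2, map_add, map_sub]
  abel

/-- The derivative of an inner product of two sections along `f`. -/
theorem fderiv_inner_along (hH : IsMetricAt H (f x)) (hf : DifferentiableAt ℝ f x)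
    {s t : V → W} (hs : DifferentiableAt ℝ s x) (ht : DifferentiableAt ℝ t x) (u : V) :
    fderiv ℝ (fun y => H (f y) (s y) (t y)) x u =
      H (f x) (covDerivAlong H f s x u) (t x) + H (f x) (s x) (covDerivAlong H f t x u) := by
  have dH := hH.differentiableAt.hasFDerivAt.comp x hf.hasFDerivAt
  have := ((dH.clm_apply hs.hasFDerivAt).clm_apply ht.hasFDerivAt).fderiv
  refine (DFunLike.congr_fun this u).trans ?_
  simp only [covDerivAlong, christoffel_eq, map_add, add_apply]
  simp [hH.fderiv_eq]
  abel

end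

/-! ### Riemannian immersions: normality, Weingarten and Gauss. -/

/-- `f : (V, G) → (W, H)` is a riemannian immersion near `x`. -/
structure IsIsometricAt (G : V → V →L[ℝ] V →L[ℝ] ℝ) (H : W → W →L[ℝ] W →L[ℝ] ℝ) (f : V → W)
    (x : V) : Prop where
  contDiffAt : ContDiffAt ℝ 3 f x
  dom : IsMetricAt G x
  cod : IsMetricAt H (f x)
  isometric : ∀ᶠ y in 𝓝 x, ∀ u v, H (f y) (fderiv ℝ f y u) (fderiv ℝ f y v) = G y u v

namespace IsIsometricAt

variable {G : V → V →L[ℝ] V →L[ℝ] ℝ} {H : W → W →L[ℝ] W →L[ℝ] ℝ} {f : V → W} {x : V}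

theorem eventually (h : IsIsometricAt G H f x) : ∀ᶠ y in 𝓝 x, IsIsometricAt G H f y := by
  filter_upwards [h.contDiffAt.eventually (by simp), h.dom.eventually,
    h.contDiffAt.continuousAt.eventually h.cod.eventually, h.isometric.eventually_nhds]
    with y h1 h2 h3 h4
  exact ⟨h1, h2, h3, h4⟩

theorem inner_eq (h : IsIsometricAt G H f x) (u v : V) :
    H (f x) (fderiv ℝ f x u) (fderiv ℝ f x v) = G x u v := h.isometric.self_of_nhds u v

theorem contDiffAt_two (h : IsIsometricAt G H f x) : ContDiffAt ℝ 2 f x :=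
  h.contDiffAt.of_le (by norm_num)

theorem differentiableAt (h : IsIsometricAt G H f x) : DifferentiableAt ℝ f x :=
  h.contDiffAt.differentiableAt (by norm_num)

theorem differentiableAt_fderiv_apply (h : IsIsometricAt G H f x) (v : V) :
    DifferentiableAt ℝ (fun y => fderiv ℝ f y v) x :=
  (differentiableAt_fderiv h.contDiffAt_two).clm_apply (differentiableAt_const v)

theorem differentiableAt_hess (h : IsIsometricAt G H f x) (v w : V) :
    DifferentiableAt ℝ (fun y => hess G H f y v w) x := by
  have e : (fun y => hess G H f y v w) =ᶠ[𝓝 x] fun y => hessCLM G H f y v w := by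
    filter_upwards [eventually_hess_eq (G := G) (H := H) h.contDiffAt_two] with y hy using hy v w
  refine DifferentiableAt.congr_of_eventuallyEq ?_ e
  exact (((contDiffAt_hessCLM h.dom h.cod h.contDiffAt).differentiableAt (by norm_num)).clm_apply
    (differentiableAt_const v)).clm_apply (differentiableAt_const w)

theorem injective (h : IsIsometricAt G H f x) : Function.Injective (fderiv ℝ f x) := by
  intro u v huv
  refine h.dom.isInner.ext fun w => ?_
  rw [← h.inner_eq, ← h.inner_eq, huv]

/-- The second fundamental form of a riemannian immersion is normal. -/
theorem hess_normal (h : IsIsometricAt G H f x) (u v w : V) :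
    H (f x) (hess G H f x u v) (fderiv ℝ f x w) = 0 := by
  -- Derivative of `⟨df v, df w⟩ = G(v, w)` along `u`; by metric compatibility the Christoffel terms
  -- of `G` cancel.
  have key (u v w : V) : H (f x) (hess G H f x u v) (fderiv ℝ f x w)
      + H (f x) (hess G H f x u w) (fderiv ℝ f x v) = 0 := by
    have h1 := fderiv_inner_along h.cod h.differentiableAt
      (h.differentiableAt_fderiv_apply v) (h.differentiableAt_fderiv_apply w) u
    have e : (fun y => H (f y) (fderiv ℝ f y v) (fderiv ℝ f y w)) =ᶠ[𝓝 x] fun y => G y v w := by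
      filter_upwards [h.isometric] with y hy using hy v w
    rw [e.fderiv_eq] at h1
    have h2 : fderiv ℝ (fun y => G y v w) x u = fderiv ℝ G x u v w := by
      have := ((h.dom.differentiableAt.hasFDerivAt.clm_apply (hasFDerivAt_const v x)).clm_apply
        (hasFDerivAt_const w x)).fderiv
      refine (DFunLike.congr_fun this u).trans ?_
      simp
    rw [h2, h.dom.fderiv_eq, covDerivAlong_fderiv (G := G), covDerivAlong_fderiv (G := G)] at h1
    simp only [map_add, add_apply, h.inner_eq] at h1
    rw [h.cod.isInner.symm (hess G H f x u w)]
    linarith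
  have symm (u v w : V) : H (f x) (hess G H f x u v) (fderiv ℝ f x w) =
      H (f x) (hess G H f x v u) (fderiv ℝ f x w) := by
    rw [hess_eq h.contDiffAt_two, hess_eq h.contDiffAt_two,
      hessCLM_symm h.dom h.cod h.contDiffAt_two]
  -- A trilinear form symmetric in its first two arguments and antisymmetric in its last two is
  -- zero: combine the cyclic permutations.
  have k1 := key u v w
  have k2 := key v w u
  have k3 := key w u v
  rw [symm v w u] at k2
  rw [symm w u v] at k3
  rw [symm v u w] at k2
  linarith

/-- The Weingarten equation: differentiate `⟨s, df w⟩ = 0`. The Christoffel part of `∇_u(df w)` is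
tangential, hence orthogonal to `s`. -/
theorem inner_covDerivAlong_eq (h : IsIsometricAt G H f x) {s : V → W}
    (hs : DifferentiableAt ℝ s x)
    (hn : ∀ᶠ y in 𝓝 x, ∀ w, H (f y) (s y) (fderiv ℝ f y w) = 0) (u w : V) :
    H (f x) (covDerivAlong H f s x u) (fderiv ℝ f x w) = - H (f x) (s x) (hess G H f x u w) := by
  have h1 := fderiv_inner_along h.cod h.differentiableAt hs
    (h.differentiableAt_fderiv_apply w) u
  have e : (fun y => H (f y) (s y) (fderiv ℝ f y w)) =ᶠ[𝓝 x] fun _ => 0 := by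
    filter_upwards [hn] with y hy using hy w
  rw [e.fderiv_eq, covDerivAlong_fderiv (G := G), map_add, hn.self_of_nhds] at h1
  simp at h1
  linarith

/-- The Gauss equation. -/
theorem inner_curvature (h : IsIsometricAt G H f x) (u v w z : V) :
    H (f x) (curvature G H f x u v w) (fderiv ℝ f x z) =
      H (f x) (hess G H f x u w) (hess G H f x v z)
        - H (f x) (hess G H f x v w) (hess G H f x u z) := by
  -- The two correction terms of the second covariant derivative are values of `∇df`, hence normal;
  -- Weingarten with `s = ∇df(v, w)` gives the rest.
  have key (u v w : V) : H (f x) (hess₂ G H f x u v w) (fderiv ℝ f x z) =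
      - H (f x) (hess G H f x v w) (hess G H f x u z) := by
    rw [hess₂, map_sub, map_sub, sub_apply, sub_apply, h.hess_normal, h.hess_normal,
      h.inner_covDerivAlong_eq (h.differentiableAt_hess v w)]
    · simp
    · filter_upwards [h.eventually] with y hy z using hy.hess_normal v w z
  rw [curvature, map_sub, sub_apply, key, key]
  ring

end IsIsometricAt

/-! ### Compositions, and traces in an orthonormal basis. -/

/-- The second fundamental form of a composition. -/
theorem hess_comp {X : Type*} [NormedAddCommGroup X] [NormedSpace ℝ X] [FiniteDimensional ℝ X]
    (G : V → V →L[ℝ] V →L[ℝ] ℝ) (H : W → W →L[ℝ] W →L[ℝ] ℝ) (K : X → X →L[ℝ] X →L[ℝ] ℝ)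
    {f : V → W} {k : W → X} {x : V} (hf : ContDiffAt ℝ 2 f x) (hk : ContDiffAt ℝ 2 k (f x))
    (u v : V) :
    hess G K (k ∘ f) x u v = hess H K k (f x) (fderiv ℝ f x u) (fderiv ℝ f x v)
      + fderiv ℝ k (f x) (hess G H f x u v) := by
  have hd : ∀ᶠ y in 𝓝 x, fderiv ℝ (k ∘ f) y = (fderiv ℝ k (f y)).comp (fderiv ℝ f y) := by
    filter_upwards [hf.eventually (by simp), hf.continuousAt.eventually (hk.eventually (by simp))]
      with y h1 h2
    exact fderiv_comp y (h2.differentiableAt (by norm_num)) (h1.differentiableAt (by norm_num))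
  have d0 : HasFDerivAt f (fderiv ℝ f x) x := (hf.differentiableAt (by norm_num)).hasFDerivAt
  have d1 := (differentiableAt_fderiv hf).hasFDerivAt
  have dk := (differentiableAt_fderiv hk).hasFDerivAt.comp x d0
  have h2 : fderiv ℝ (fderiv ℝ (k ∘ f)) x u v =
      fderiv ℝ (fderiv ℝ k) (f x) (fderiv ℝ f x u) (fderiv ℝ f x v)
        + fderiv ℝ k (f x) (fderiv ℝ (fderiv ℝ f) x u v) := by
    rw [Filter.EventuallyEq.fderiv_eq hd]
    have := (dk.clm_comp d1).fderiv
    refine (DFunLike.congr_fun (DFunLike.congr_fun this u) v).trans ?_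
    simp
    abel
  rw [hess_eq (hk.comp x hf), hess_eq hk, hess_eq hf, hessCLM_apply, hessCLM_apply, hessCLM_apply,
    h2, hd.self_of_nhds]
  simp
  abel

/-- Needed because coordinate expressions of composite maps factor only near the point. -/
theorem hess_congr {G : V → V →L[ℝ] V →L[ℝ] ℝ} {H : W → W →L[ℝ] W →L[ℝ] ℝ} {f k : V → W} {x : V}
    (h : f =ᶠ[𝓝 x] k) : hess G H f x = hess G H k x := by
  ext u v
  have h1 : fderiv ℝ f =ᶠ[𝓝 x] fderiv ℝ k := h.fderiv
  have h2 : (fun y => fderiv ℝ f y v) =ᶠ[𝓝 x] fun y => fderiv ℝ k y v := by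
    filter_upwards [h1] with y hy
    rw [hy]
  rw [hess, hess, covDerivAlong, covDerivAlong, h2.fderiv_eq, h1.eq_of_nhds, h.eq_of_nhds]

theorem hess_eventuallyEq {G : V → V →L[ℝ] V →L[ℝ] ℝ} {H : W → W →L[ℝ] W →L[ℝ] ℝ} {f k : V → W}
    {x : V} (h : f =ᶠ[𝓝 x] k) : hess G H f =ᶠ[𝓝 x] hess G H k := by
  filter_upwards [h.eventuallyEq_nhds] with y hy using hess_congr hy

theorem metricTrace_eq_sum_of_isLinearMap {n : Type*} [Fintype n] [DecidableEq n]
    {B : V →L[ℝ] V →L[ℝ] ℝ} {e : Module.Basis n ℝ V}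
    (he : ∀ i j, B (e i) (e j) = if i = j then 1 else 0) {T : V → V → W}
    (h₁ : ∀ v, IsLinearMap ℝ fun u => T u v) (h₂ : ∀ u, IsLinearMap ℝ (T u)) :
    metricTrace B T = ∑ i, T (e i) (e i) :=
  metricTrace_eq_sum B (LinearMap.mk₂ ℝ T (fun u u' v => (h₁ v).map_add u u')
    (fun c u v => (h₁ v).map_smul c u) (fun u v v' => (h₂ u).map_add v v')
    (fun c u v => (h₂ u).map_smul c v)) e he

section

variable {n : Type*} [Fintype n] [DecidableEq n]

theorem apply_self_eq_sum_sq {B : V →L[ℝ] V →L[ℝ] ℝ} {e : Module.Basis n ℝ V}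
    (he : ∀ i j, B (e i) (e j) = if i = j then 1 else 0) (u : V) :
    B u u = ∑ i, B u (e i) ^ 2 := by
  conv_lhs => arg 2; rw [← e.sum_repr u]
  simp only [map_sum, map_smul, smul_eq_mul, IsInner.repr_eq he]
  exact Finset.sum_congr rfl fun i _ => by ring

variable {G : V → V →L[ℝ] V →L[ℝ] ℝ} {H : W → W →L[ℝ] W →L[ℝ] ℝ} {f : V → W} {x : V}
  {e : Module.Basis n ℝ V}

theorem tension_eq_sum (he : ∀ i j, G x (e i) (e j) = if i = j then 1 else 0)
    (hf : ContDiffAt ℝ 2 f x) : tension G H f x = ∑ i, hess G H f x (e i) (e i) :=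
  metricTrace_eq_sum' he (hessCLM G H f x) (hess_eq hf)

theorem normSqHess_eq_sum (he : ∀ i j, G x (e i) (e j) = if i = j then 1 else 0)
    (hf : ContDiffAt ℝ 2 f x) : normSqHess G H f x =
      ∑ i, ∑ j, H (f x) (hess G H f x (e i) (e j)) (hess G H f x (e i) (e j)) := by
  have h1 (u u' : V) : metricTrace (G x) (fun v v' =>
      H (f x) (hess G H f x u v) (hess G H f x u' v')) =
      ∑ j, H (f x) (hess G H f x u (e j)) (hess G H f x u' (e j)) := by
    refine metricTrace_eq_sum_of_isLinearMap he (fun v => ?_) (fun v => ?_) <;> constructor <;>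
      simp [hess_eq hf]
  simp only [normSqHess, h1]
  refine metricTrace_eq_sum_of_isLinearMap he (fun v => ?_) (fun v => ?_) <;> constructor <;>
    simp [hess_eq hf, Finset.sum_add_distrib, Finset.mul_sum]

theorem innerDiff_eq_sum (he : ∀ i j, G x (e i) (e j) = if i = j then 1 else 0)
    {A : V → W} (hA : IsLinearMap ℝ A) :
    innerDiff G H f x A = ∑ i, H (f x) (fderiv ℝ f x (e i)) (A (e i)) := by
  refine metricTrace_eq_sum_of_isLinearMap he (fun v => ?_) (fun v => ?_) <;> constructor <;>
    simp [hA.map_add, hA.map_smul]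

theorem isLinearMap_riemann₁ (y b c : W) : IsLinearMap ℝ fun a => riemann H y a b c := by
  constructor
  · intro u v
    simp only [riemann, map_add, add_apply]
    abel
  · intro c u
    simp only [riemann, map_smul, smul_apply]
    module

theorem isLinearMap_riemann₂ (y a c : W) : IsLinearMap ℝ fun b => riemann H y a b c := by
  constructor
  · intro u v
    simp only [riemann, map_add, add_apply]
    abel
  · intro c u
    simp only [riemann, map_smul, smul_apply]
    module

theorem isLinearMap_riemann₃ (y a b : W) : IsLinearMap ℝ fun c => riemann H y a b c := by
  constructor
  · intro u v
    simp only [riemann, map_add]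
    abel
  · intro c u
    simp only [riemann, map_smul]
    module

/-- Evaluating the traces in an orthonormal basis requires linearity in each slot, which the
definition of `curvature` hides and `curvature_eq` makes visible. -/
theorem innerDiff_ricci_eq_sum (he : ∀ i j, G x (e i) (e j) = if i = j then 1 else 0)
    (hG : IsMetricAt G x) (hH : IsMetricAt H (f x)) (hf : ContDiffAt ℝ 3 f x) :
    innerDiff G H f x (ricci G H f x) =
      ∑ i, ∑ j, H (f x) (fderiv ℝ f x (e i)) (curvature G H f x (e i) (e j) (e j)) := by
  have h1 (u : V) : ricci G H f x u = ∑ j, curvature G H f x u (e j) (e j) := by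
    refine metricTrace_eq_sum_of_isLinearMap he (fun v => ?_) (fun v => ?_) <;> constructor <;>
      intro a b <;> simp only [curvature_eq hG hH hf, map_add, map_smul,
        (isLinearMap_riemann₂ _ _ _).map_add, (isLinearMap_riemann₂ _ _ _).map_smul,
        (isLinearMap_riemann₃ _ _ _).map_add, (isLinearMap_riemann₃ _ _ _).map_smul] <;> module
  have h2 : IsLinearMap ℝ (ricci G H f x) := by
    constructor <;> intro a b <;> simp only [h1, curvature_eq hG hH hf, map_add, map_smul,
        (isLinearMap_riemann₁ _ _ _).map_add, (isLinearMap_riemann₁ _ _ _).map_smul,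
        Finset.smul_sum, ← Finset.sum_add_distrib] <;>
      refine Finset.sum_congr rfl fun j _ => ?_ <;> module
  rw [innerDiff_eq_sum he h2]
  simp only [h1, map_sum]

namespace IsIsometricAt

/-- The tension field is normal, being a trace of normal vectors, so Weingarten gives `-⟨τ, ∇df(eᵢ,
eᵢ)⟩`, whose sum is `-|τ|²`. -/
theorem innerDiff_covDerivAlong_tension (h : IsIsometricAt G H f x) :
    innerDiff G H f x (covDerivAlong H f (tension G H f) x) = - normSqTension G H f x := by
  have := FiniteDimensional.complete ℝ V
  obtain ⟨e, he⟩ := h.dom.isInner.exists_basis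
  have hd : DifferentiableAt ℝ (tension G H f) x := by
    -- The basis `e` is orthonormal at `x` only. Differentiability is read from the fixed basis and
    -- the inverse metric, which vary well with the point.
    have e1 : tension G H f =ᶠ[𝓝 x] fun y => ∑ i, hessCLM G H f y (Module.finBasis ℝ V i)
        ((G y).inverse (LinearMap.toContinuousLinearMap ((Module.finBasis ℝ V).coord i))) := by
      filter_upwards [eventually_hess_eq (G := G) (H := H) h.contDiffAt_two] with y hy
      simp only [tension, metricTrace, hy]
    refine DifferentiableAt.congr_of_eventuallyEq ?_ e1
    have hi : DifferentiableAt ℝ (fun y => (G y).inverse) x :=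
      ((h.dom.isInner.isInvertible.contDiffAt_map_inverse (n := 1)).comp x
        (h.dom.contDiffAt.of_le (by norm_num))).differentiableAt (by norm_num)
    have hh := (contDiffAt_hessCLM h.dom h.cod h.contDiffAt).differentiableAt (by norm_num)
    refine DifferentiableAt.fun_sum fun i _ => ?_
    exact (hh.clm_apply (differentiableAt_const _)).clm_apply
      (hi.clm_apply (differentiableAt_const _))
  have hn : ∀ᶠ y in 𝓝 x, ∀ w, H (f y) (tension G H f y) (fderiv ℝ f y w) = 0 := by
    filter_upwards [h.eventually] with y hy w
    simp only [tension, metricTrace, map_sum, sum_apply, hy.hess_normal, Finset.sum_const_zero]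
  have hl : IsLinearMap ℝ (covDerivAlong H f (tension G H f) x) := by
    constructor <;> intro a b <;> simp only [covDerivAlong, christoffel_eq, map_add, map_smul,
      add_apply, smul_apply]
    · abel
    · module
  rw [innerDiff_eq_sum he hl, normSqTension]
  simp only [h.cod.isInner.symm (fderiv ℝ f x _), h.inner_covDerivAlong_eq hd hn]
  rw [Finset.sum_neg_distrib, ← map_sum, ← tension_eq_sum he h.contDiffAt_two]

/-- The trace of the Gauss equation. -/
theorem sum_inner_curvature (h : IsIsometricAt G H f x)
    (he : ∀ i j, G x (e i) (e j) = if i = j then 1 else 0) :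
    ∑ i, ∑ j, H (f x) (fderiv ℝ f x (e i)) (curvature G H f x (e i) (e j) (e j)) =
      normSqHess G H f x - normSqTension G H f x := by
  rw [normSqHess_eq_sum he h.contDiffAt_two, normSqTension, tension_eq_sum he h.contDiffAt_two]
  simp only [map_sum, sum_apply]
  rw [← Finset.sum_sub_distrib]
  refine Finset.sum_congr rfl fun i _ => ?_
  rw [← Finset.sum_sub_distrib]
  refine Finset.sum_congr rfl fun j _ => ?_
  rw [h.cod.isInner.symm (fderiv ℝ f x _), h.inner_curvature,
    hess_eq h.contDiffAt_two (e j) (e i), hess_eq h.contDiffAt_two (e i) (e j),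
    hessCLM_symm h.dom h.cod h.contDiffAt_two (e j) (e i),
    h.cod.isInner.symm (hess G H f x (e j) (e j))]

/-- By `curvature_eq` the curvature of `df` is the ambient curvature minus the intrinsic one, so the
traced Gauss equation relates the ambient trace to the scalar curvature of the source. It serves for
`γ`, and for `ι`, where the left side is zero. -/
theorem sum_inner_riemann (h : IsIsometricAt G H f x)
    (he : ∀ i j, G x (e i) (e j) = if i = j then 1 else 0) :
    ∑ i, ∑ j, H (f x) (fderiv ℝ f x (e i))
        (riemann H (f x) (fderiv ℝ f x (e i)) (fderiv ℝ f x (e j)) (fderiv ℝ f x (e j))) =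
      ∑ i, ∑ j, G x (e i) (riemann G x (e i) (e j) (e j))
        + normSqHess G H f x - normSqTension G H f x := by
  rw [add_sub_assoc, ← h.sum_inner_curvature he, ← Finset.sum_add_distrib]
  refine Finset.sum_congr rfl fun i _ => ?_
  rw [← Finset.sum_add_distrib]
  refine Finset.sum_congr rfl fun j _ => ?_
  rw [curvature_eq h.dom h.cod h.contDiffAt, map_sub, h.inner_eq]
  ring

end IsIsometricAt

end

/-! ### Euclidean targets and the orthogonal projection onto a submanifold. -/

section Constant

theorem christoffelCLM_const (B : V →L[ℝ] V →L[ℝ] ℝ) : christoffelCLM (fun _ => B) = 0 := by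
  ext x u v
  simp [christoffelCLM]

theorem isMetricAt_const {B : V →L[ℝ] V →L[ℝ] ℝ} (hB : IsInner B) (x : V) :
    IsMetricAt (fun _ => B) x :=
  ⟨contDiffAt_const, Filter.Eventually.of_forall fun _ => hB⟩

theorem riemann_const (B : V →L[ℝ] V →L[ℝ] ℝ) (x u v w : V) :
    riemann (fun _ => B) x u v w = 0 := by
  simp [riemann, christoffelCLM_const]

end Constant

variable {F : Type*} [NormedAddCommGroup F] [InnerProductSpace ℝ F] [FiniteDimensional ℝ F]

variable (F) in
/-- The inner product of a euclidean space. -/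
noncomputable def euclideanInner : F →L[ℝ] F →L[ℝ] ℝ := innerSL ℝ

theorem euclideanInner_apply (u v : F) : euclideanInner F u v = inner ℝ u v := rfl

theorem isInner_euclideanInner : IsInner (euclideanInner F) :=
  ⟨fun u v => by simp [euclideanInner_apply, real_inner_comm],
    fun u hu => real_inner_self_pos.2 hu⟩

/-- An orthonormal basis of `V` extends to an orthonormal basis of an isometric extension. -/
theorem exists_adapted_basis {n : Type*} [Fintype n] [DecidableEq n] {B : V →L[ℝ] V →L[ℝ] ℝ}
    {L : V →L[ℝ] F} (hL : ∀ u v, euclideanInner F (L u) (L v) = B u v) {e : Module.Basis n ℝ V}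
    (he : ∀ i j, B (e i) (e j) = if i = j then 1 else 0) :
    ∃ (m : ℕ) (b : Module.Basis (n ⊕ Fin m) ℝ F), (∀ i, b (Sum.inl i) = L (e i)) ∧
      ∀ s t, euclideanInner F (b s) (b t) = if s = t then (1 : ℝ) else 0 := by
  have hinj : Function.Injective (L : V →ₗ[ℝ] F) := by
    rw [← LinearMap.ker_eq_bot, LinearMap.ker_eq_bot']
    intro u hu
    have hu' : L u = 0 := hu
    have h0 : ∀ v, B u v = 0 := fun v => by rw [← hL, hu']; simp
    have := e.sum_repr u
    simp only [IsInner.repr_eq he, h0] at this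
    simpa using this.symm
  set K := LinearMap.range (L : V →ₗ[ℝ] F) with hK
  set ν := stdOrthonormalBasis ℝ Kᗮ
  let b₀ : n ⊕ Fin (Module.finrank ℝ Kᗮ) → F := Sum.elim (fun i => L (e i)) fun a => (ν a : F)
  have hperp : ∀ i a, inner ℝ (L (e i)) (ν a : F) = 0 := fun i a =>
    (ν a).2 _ (LinearMap.mem_range_self (L : V →ₗ[ℝ] F) (e i))
  have horth : Orthonormal ℝ b₀ := by
    rw [orthonormal_iff_ite]
    rintro (i | a) (j | b)
    · have := hL (e i) (e j)
      simp only [euclideanInner_apply] at this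
      simp [b₀, this, he]
    · simp [b₀, hperp]
    · simp [b₀, real_inner_comm, hperp]
    · have := orthonormal_iff_ite.mp ν.orthonormal a b
      simpa [b₀] using this
  have hcard : Fintype.card (n ⊕ Fin (Module.finrank ℝ Kᗮ)) = Module.finrank ℝ F := by
    rw [Fintype.card_sum, Fintype.card_fin, ← Module.finrank_eq_card_basis e,
      ← LinearMap.finrank_range_of_inj hinj]
    exact K.finrank_add_finrank_orthogonal
  -- `basisOfLinearIndependentOfCardEqFinrank` asks for a nonempty index type, so dimension zero is
  -- separate.
  by_cases hne : Nonempty (n ⊕ Fin (Module.finrank ℝ Kᗮ))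
  · refine ⟨_, basisOfLinearIndependentOfCardEqFinrank horth.linearIndependent hcard, ?_, ?_⟩
    · intro i
      simp [b₀]
    · intro s t
      simpa [euclideanInner_apply] using orthonormal_iff_ite.mp horth s t
  · rw [not_nonempty_iff] at hne
    have : Subsingleton F := by
      apply (Module.finrank_zero_iff (R := ℝ)).mp
      rw [← hcard, Fintype.card_eq_zero]
    refine ⟨_, Module.Basis.empty F, fun i => hne.elim (Sum.inl i), fun s => hne.elim s⟩

/-- `P` is the orthogonal projection near `f x` onto the image of `f`, in coordinates. -/
structure IsProjectionAt (G : V → V →L[ℝ] V →L[ℝ] ℝ) (f : V → F) (P : F → V) (x : V) : Prop where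
  isometric : IsIsometricAt G (fun _ => euclideanInner F) f x
  contDiffAt : ContDiffAt ℝ 3 P (f x)
  apply_eq : P (f x) = x
  critical : ∀ᶠ y in 𝓝 (f x), ∀ v, euclideanInner F (y - f (P y)) (fderiv ℝ f (P y) v) = 0

namespace IsProjectionAt

variable {G : V → V →L[ℝ] V →L[ℝ] ℝ} {f : V → F} {P : F → V} {x : V}

theorem contDiffAt_two (h : IsProjectionAt G f P x) : ContDiffAt ℝ 2 P (f x) :=
  h.contDiffAt.of_le (by norm_num)

/-- The critical equation differentiated once in the direction `z`. It is kept on a neighbourhood so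
that it can be differentiated again. -/
theorem eventually_fderiv_critical (h : IsProjectionAt G f P x) :
    ∀ᶠ y in 𝓝 (f x), ∀ z v,
      inner ℝ (z - fderiv ℝ f (P y) (fderiv ℝ P y z)) (fderiv ℝ f (P y) v)
        + inner ℝ (y - f (P y)) (fderiv ℝ (fderiv ℝ f) (P y) (fderiv ℝ P y z) v) = 0 := by
  have hc : Tendsto P (𝓝 (f x)) (𝓝 x) := by
    simpa [h.apply_eq] using h.contDiffAt.continuousAt.tendsto
  filter_upwards [h.critical.eventually_nhds, h.contDiffAt.eventually (by simp),
    hc.eventually h.isometric.eventually] with y h1 h2 h3 z v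
  have dP : HasFDerivAt P (fderiv ℝ P y) y := (h2.differentiableAt (by norm_num)).hasFDerivAt
  have df : HasFDerivAt (fun y => f (P y)) ((fderiv ℝ f (P y)).comp (fderiv ℝ P y)) y :=
    h3.differentiableAt.hasFDerivAt.comp y dP
  have df' := (differentiableAt_fderiv h3.contDiffAt_two).hasFDerivAt.comp y dP
  have key := ((hasFDerivAt_id y).sub df).inner ℝ (df'.clm_apply (hasFDerivAt_const v y))
  have e : (fun y => inner ℝ (((id : F → F) - fun y => f (P y)) y) ((fderiv ℝ f ∘ P) y v)) =ᶠ[𝓝 y]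
      fun _ => (0 : ℝ) := by
    filter_upwards [h1] with w hw
    exact hw v
  have := DFunLike.congr_fun (key.unique ((hasFDerivAt_const (0 : ℝ) y).congr_of_eventuallyEq e)) z
  simp [fderivInnerCLM_apply] at this
  linarith

/-- On the submanifold the residual `y - f(P y)` is zero, so the differentiated equation says that
`dP` is the adjoint of `df`. -/
theorem inner_fderiv (h : IsProjectionAt G f P x) (z : F) (v : V) :
    G x (fderiv ℝ P (f x) z) v = inner ℝ z (fderiv ℝ f x v) := by
  have := h.eventually_fderiv_critical.self_of_nhds z v
  rw [h.apply_eq, sub_self, inner_zero_left, add_zero, inner_sub_left, sub_eq_zero] at this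
  rw [this, ← h.isometric.inner_eq, euclideanInner_apply]

theorem fderiv_fderiv (h : IsProjectionAt G f P x) (v : V) :
    fderiv ℝ P (f x) (fderiv ℝ f x v) = v := by
  refine h.isometric.dom.isInner.ext fun w => ?_
  rw [h.inner_fderiv, ← h.isometric.inner_eq, euclideanInner_apply]

theorem inner_sub_fderiv (h : IsProjectionAt G f P x) (z : F) (v : V) :
    inner ℝ (z - fderiv ℝ f x (fderiv ℝ P (f x) z)) (fderiv ℝ f x v) = 0 := by
  have := h.isometric.inner_eq (fderiv ℝ P (f x) z) v
  simp only [euclideanInner_apply] at this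
  rw [inner_sub_left, ← h.inner_fderiv, this, sub_self]

/-- The second derivative of the critical equation at `f x`. The third derivative of `f` appears
only paired with the residual `y - f(P y)`, which vanishes there. -/
theorem inner_fderiv_fderiv (h : IsProjectionAt G f P x) (z₁ z₂ : F) (v : V) :
    G x (fderiv ℝ (fderiv ℝ P) (f x) z₁ z₂) v
        + inner ℝ (fderiv ℝ (fderiv ℝ f) x (fderiv ℝ P (f x) z₁) (fderiv ℝ P (f x) z₂))
          (fderiv ℝ f x v) =
      inner ℝ (z₁ - fderiv ℝ f x (fderiv ℝ P (f x) z₁))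
          (fderiv ℝ (fderiv ℝ f) x (fderiv ℝ P (f x) z₂) v)
        + inner ℝ (z₂ - fderiv ℝ f x (fderiv ℝ P (f x) z₂))
          (fderiv ℝ (fderiv ℝ f) x (fderiv ℝ P (f x) z₁) v) := by
  have hi := h.isometric
  have dP : HasFDerivAt P (fderiv ℝ P (f x)) (f x) :=
    (h.contDiffAt.differentiableAt (by norm_num)).hasFDerivAt
  have dP' := (differentiableAt_fderiv h.contDiffAt_two).hasFDerivAt
  have df := (h.apply_eq.symm ▸ hi.differentiableAt.hasFDerivAt :
    HasFDerivAt f (fderiv ℝ f x) (P (f x))).comp (f x) dP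
  have df' := (h.apply_eq.symm ▸ (differentiableAt_fderiv hi.contDiffAt_two).hasFDerivAt :
    HasFDerivAt (fderiv ℝ f) (fderiv ℝ (fderiv ℝ f) x) (P (f x))).comp (f x) dP
  have df'' := (h.apply_eq.symm ▸ (differentiableAt_fderiv
    (hi.contDiffAt.fderiv_right (m := 2) (by norm_num))).hasFDerivAt :
    HasFDerivAt (fderiv ℝ (fderiv ℝ f)) (fderiv ℝ (fderiv ℝ (fderiv ℝ f)) x)
      (P (f x))).comp (f x) dP
  have dPz := dP'.clm_apply (hasFDerivAt_const z₂ (f x))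
  have k1 := ((hasFDerivAt_const z₂ (f x)).sub (df'.clm_apply dPz)).inner ℝ
    (df'.clm_apply (hasFDerivAt_const v (f x)))
  have k2 := ((hasFDerivAt_id (f x)).sub df).inner ℝ ((df''.clm_apply dPz).clm_apply
    (hasFDerivAt_const v (f x)))
  have e := h.eventually_fderiv_critical
  have e' : (fun y => inner ℝ (z₂ - fderiv ℝ f (P y) (fderiv ℝ P y z₂)) (fderiv ℝ f (P y) v)
        + inner ℝ (y - f (P y)) (fderiv ℝ (fderiv ℝ f) (P y) (fderiv ℝ P y z₂) v)) =ᶠ[𝓝 (f x)]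
      fun _ => (0 : ℝ) := by
    filter_upwards [e] with y hy using hy z₂ v
  have := DFunLike.congr_fun ((k1.add k2).unique 
    ((hasFDerivAt_const (0 : ℝ) (f x)).congr_of_eventuallyEq e')) z₁
  simp [fderivInnerCLM_apply, h.apply_eq] at this
  have h2 := hi.inner_eq (fderiv ℝ (fderiv ℝ P) (f x) z₁ z₂) v
  simp only [euclideanInner_apply] at h2
  rw [← h2]
  simp only [inner_add_left, inner_neg_left, inner_sub_left] at this ⊢
  linarith

/-- The second fundamental form of the orthogonal projection. -/
theorem inner_hess (h : IsProjectionAt G f P x) (z₁ z₂ : F) (v : V) :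
    G x (hess (fun _ => euclideanInner F) G P (f x) z₁ z₂) v =
      inner ℝ (z₁ - fderiv ℝ f x (fderiv ℝ P (f x) z₁))
          (hess G (fun _ => euclideanInner F) f x (fderiv ℝ P (f x) z₂) v)
        + inner ℝ (z₂ - fderiv ℝ f x (fderiv ℝ P (f x) z₂))
          (hess G (fun _ => euclideanInner F) f x (fderiv ℝ P (f x) z₁) v) := by
  -- Passing to covariant derivatives: the Christoffel part of the second derivative of `f` is
  -- tangential. It disappears against the normal components of `z₁`, `z₂`, and elsewhere supplies
  -- the Christoffel term of `∇dP`.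
  have h1 (a b : V) : fderiv ℝ (fderiv ℝ f) x a b = hess G (fun _ => euclideanInner F) f x a b
      + fderiv ℝ f x (christoffelCLM G x a b) := by
    rw [hess_eq h.isometric.contDiffAt_two, hessCLM_apply, christoffelCLM_const]
    simp
  have := h.inner_fderiv_fderiv z₁ z₂ v
  simp only [h1, inner_add_left, inner_add_right, h.inner_sub_fderiv] at this
  have hn := h.isometric.hess_normal (fderiv ℝ P (f x) z₁) (fderiv ℝ P (f x) z₂) v
  have hi := h.isometric.inner_eq (christoffelCLM G x (fderiv ℝ P (f x) z₁) (fderiv ℝ P (f x) z₂)) v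
  simp only [euclideanInner_apply] at hn hi
  rw [hess_eq h.contDiffAt_two, hessCLM_apply, christoffelCLM_const, h.apply_eq]
  simp only [Pi.zero_apply, zero_apply, map_zero, sub_zero, map_add,
    add_apply]
  linarith

end IsProjectionAt

section

variable {n : Type*} [Fintype n] [DecidableEq n]
variable {G : V → V →L[ℝ] V →L[ℝ] ℝ} {H : W → W →L[ℝ] W →L[ℝ] ℝ} {f : V → F} {P : F → V} {x : V}
  {k : V → W}

/-- In a basis adapted to tangent and normal directions, `∇dP` has only mixed blocks. They are
transposes of each other, and each contributes `|∇df|²`; this is the source of the factor `2`. -/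
theorem normSqHess_comp_projection (h : IsProjectionAt G f P x) (hk : IsIsometricAt G H k x) :
    normSqHess (fun _ => euclideanInner F) H (k ∘ P) (f x) =
      normSqHess G H k x + 2 * normSqHess G (fun _ => euclideanInner F) f x := by
  obtain ⟨e, he⟩ := h.isometric.dom.isInner.exists_basis
  obtain ⟨m, b, hb, hb'⟩ := exists_adapted_basis h.isometric.inner_eq he
  have hk2 : ContDiffAt ℝ 2 k (P (f x)) := by rw [h.apply_eq]; exact hk.contDiffAt_two
  have hfe (i) : fderiv ℝ P (f x) (b (Sum.inl i)) = e i := by rw [hb, h.fderiv_fderiv]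
  have hperp (a : Fin m) (v : V) : inner ℝ (b (Sum.inr a)) (fderiv ℝ f x v) = 0 := by
    have := fun i => hb' (Sum.inr a) (Sum.inl i)
    simp only [hb, euclideanInner_apply, reduceCtorEq, if_false] at this
    rw [← e.sum_repr v]
    simp only [map_sum, map_smul, inner_sum, inner_smul_right, this, mul_zero,
      Finset.sum_const_zero]
  have hfν (a) : fderiv ℝ P (f x) (b (Sum.inr a)) = 0 :=
    h.isometric.dom.isInner.eq_zero_of_forall fun v => by rw [h.inner_fderiv, hperp]
  -- Pythagoras: `∇dk` is normal while `dk(∇dP)` is tangential and isometric to `∇dP`.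
  have hcomp (z₁ z₂ : F) :
      H (k x) (hess (fun _ => euclideanInner F) H (k ∘ P) (f x) z₁ z₂)
        (hess (fun _ => euclideanInner F) H (k ∘ P) (f x) z₁ z₂) =
      H (k x) (hess G H k x (fderiv ℝ P (f x) z₁) (fderiv ℝ P (f x) z₂))
        (hess G H k x (fderiv ℝ P (f x) z₁) (fderiv ℝ P (f x) z₂)) +
      G x (hess (fun _ => euclideanInner F) G P (f x) z₁ z₂)
        (hess (fun _ => euclideanInner F) G P (f x) z₁ z₂) := by
    rw [hess_comp _ G H h.contDiffAt_two hk2, h.apply_eq]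
    simp only [map_add, add_apply]
    rw [hk.inner_eq, hk.hess_normal, hk.cod.isInner.symm (fderiv ℝ k x _), hk.hess_normal]
    ring
  have hP (z₁ z₂ : F) := apply_self_eq_sum_sq he (hess (fun _ => euclideanInner F) G P (f x) z₁ z₂)
  have hf := h.isometric.contDiffAt_two
  -- Tangent vectors have no normal component; for normal vectors `dP` vanishes. Each term of
  -- `inner_hess` needs one of each kind.
  have hll (i j) : G x (hess (fun _ => euclideanInner F) G P (f x) (b (Sum.inl i)) (b (Sum.inl j)))
      (hess (fun _ => euclideanInner F) G P (f x) (b (Sum.inl i)) (b (Sum.inl j))) = 0 := by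
    rw [hP]
    refine Finset.sum_eq_zero fun l _ => ?_
    rw [h.inner_hess, hfe, hfe, hb, hb, sub_self, sub_self]
    simp
  have hrr (i j) : G x (hess (fun _ => euclideanInner F) G P (f x) (b (Sum.inr i)) (b (Sum.inr j)))
      (hess (fun _ => euclideanInner F) G P (f x) (b (Sum.inr i)) (b (Sum.inr j))) = 0 := by
    rw [hP]
    refine Finset.sum_eq_zero fun l _ => ?_
    rw [h.inner_hess, hfν, hfν, hess_eq hf]
    simp
  have hlr (i a) : G x (hess (fun _ => euclideanInner F) G P (f x) (b (Sum.inl i)) (b (Sum.inr a)))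
      (hess (fun _ => euclideanInner F) G P (f x) (b (Sum.inl i)) (b (Sum.inr a))) =
      ∑ l, inner ℝ (hess G (fun _ => euclideanInner F) f x (e i) (e l)) (b (Sum.inr a)) ^ 2 := by
    rw [hP]
    refine Finset.sum_congr rfl fun l _ => ?_
    rw [h.inner_hess, hfν, hfe, hb, sub_self, inner_zero_left, zero_add, map_zero, sub_zero,
      real_inner_comm]
  have hrl (a i) : G x (hess (fun _ => euclideanInner F) G P (f x) (b (Sum.inr a)) (b (Sum.inl i)))
      (hess (fun _ => euclideanInner F) G P (f x) (b (Sum.inr a)) (b (Sum.inl i))) =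
      ∑ l, inner ℝ (hess G (fun _ => euclideanInner F) f x (e i) (e l)) (b (Sum.inr a)) ^ 2 := by
    rw [hP]
    refine Finset.sum_congr rfl fun l _ => ?_
    rw [h.inner_hess, hfν, hfe, hb, sub_self, inner_zero_left, add_zero, map_zero, sub_zero,
      real_inner_comm]
  -- Only normal coordinates appear, since `∇df` is normal.
  have hpars (i l) : inner ℝ (hess G (fun _ => euclideanInner F) f x (e i) (e l))
      (hess G (fun _ => euclideanInner F) f x (e i) (e l)) =
      ∑ a, inner ℝ (hess G (fun _ => euclideanInner F) f x (e i) (e l)) (b (Sum.inr a)) ^ 2 := by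
    have := apply_self_eq_sum_sq hb' (hess G (fun _ => euclideanInner F) f x (e i) (e l))
    simp only [Fintype.sum_sum_type, hb, h.isometric.hess_normal] at this
    simpa [euclideanInner_apply] using this
  rw [normSqHess_eq_sum hb' (hk2.comp _ h.contDiffAt_two),
    normSqHess_eq_sum he hk.contDiffAt_two, normSqHess_eq_sum he hf]
  simp only [Function.comp_apply, h.apply_eq, hcomp, Fintype.sum_sum_type, hll, hrr, hlr, hrl, hfe,
    hfν]
  simp only [hess_eq hk.contDiffAt_two, map_zero, zero_apply, add_zero, zero_add,
    Finset.sum_const_zero, euclideanInner_apply, hpars, Finset.sum_add_distrib]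
  rw [add_assoc, two_mul]
  congr 2
  · exact Finset.sum_congr rfl fun i _ => Finset.sum_comm
  · rw [Finset.sum_comm]
    exact Finset.sum_congr rfl fun i _ => Finset.sum_comm

/-- The domain is flat and `d(k ∘ P)` kills normal vectors, leaving the trace of the curvature of
`H` along `k`. The Gauss equations of `k` and of `f` eliminate the scalar curvature of `G`. -/
theorem innerDiff_ricci_comp_projection (h : IsProjectionAt G f P x)
    (hk : IsIsometricAt G H k x) :
    innerDiff (fun _ => euclideanInner F) H (k ∘ P) (f x)
        (ricci (fun _ => euclideanInner F) H (k ∘ P) (f x)) =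
      normSqTension G (fun _ => euclideanInner F) f x - normSqHess G (fun _ => euclideanInner F) f x
        + normSqHess G H k x - normSqTension G H k x := by
  obtain ⟨e, he⟩ := h.isometric.dom.isInner.exists_basis
  obtain ⟨m, b, hb, hb'⟩ := exists_adapted_basis h.isometric.inner_eq he
  have hk3 : ContDiffAt ℝ 3 k (P (f x)) := by rw [h.apply_eq]; exact hk.contDiffAt
  have hH : IsMetricAt H ((k ∘ P) (f x)) := by
    rw [Function.comp_apply, h.apply_eq]; exact hk.cod
  have hfe (i) : fderiv ℝ P (f x) (b (Sum.inl i)) = e i := by rw [hb, h.fderiv_fderiv]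
  have hfν (a) : fderiv ℝ P (f x) (b (Sum.inr a)) = 0 := by
    refine h.isometric.dom.isInner.eq_zero_of_forall fun v => ?_
    have := fun i => hb' (Sum.inr a) (Sum.inl i)
    simp only [hb, euclideanInner_apply, reduceCtorEq, if_false] at this
    rw [h.inner_fderiv, ← e.sum_repr v]
    simp only [map_sum, map_smul, inner_sum, inner_smul_right, this, mul_zero,
      Finset.sum_const_zero]
  have hd : fderiv ℝ (k ∘ P) (f x) = (fderiv ℝ k x).comp (fderiv ℝ P (f x)) := by
    rw [fderiv_comp _ (hk3.differentiableAt (by norm_num))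
      (h.contDiffAt.differentiableAt (by norm_num)), h.apply_eq]
  have s1 := hk.sum_inner_riemann he
  have s2 := h.isometric.sum_inner_riemann he
  simp only [riemann_const, map_zero, Finset.sum_const_zero] at s2
  rw [innerDiff_ricci_eq_sum hb' (isMetricAt_const isInner_euclideanInner _) hH (hk3.comp _ h.contDiffAt)]
  simp only [curvature_eq (isMetricAt_const isInner_euclideanInner (f x)) hH (hk3.comp _ h.contDiffAt),
    riemann_const, map_zero, sub_zero, hd, ContinuousLinearMap.comp_apply, Fintype.sum_sum_type,
    hfe, hfν, Function.comp_apply, h.apply_eq, zero_apply, Finset.sum_const_zero, add_zero,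
    (isLinearMap_riemann₂ _ _ _).map_zero, s1]
  linarith

end

/-! ### Riemannian density and the sub-laplacian. -/

/-- The derivative of the determinant at the identity is the trace. -/
theorem hasFDerivAt_det_comp {n : Type*} [Fintype n] [DecidableEq n] {N : V → n → n → ℝ}
    {N' : n → n → V →L[ℝ] ℝ} {x : V} (hN : ∀ i j, HasFDerivAt (fun y => N y i j) (N' i j) x)
    (h1 : ∀ i j, N x i j = if i = j then 1 else 0) :
    HasFDerivAt (fun y => Matrix.det (Matrix.of (N y))) (∑ i, N' i i) x := by
  have hprod (σ : Equiv.Perm n) : HasFDerivAt (fun y => ∏ i, N y (σ i) i)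
      (∑ i, (∏ j ∈ Finset.univ.erase i, N x (σ j) j) • N' (σ i) i) x :=
    HasFDerivAt.finsetProd fun i _ => hN (σ i) i
  have hsum : HasFDerivAt (fun y => ∑ σ : Equiv.Perm n, (σ.sign : ℝ) * ∏ i, N y (σ i) i)
      (∑ σ : Equiv.Perm n, (σ.sign : ℝ) •
        ∑ i, (∏ j ∈ Finset.univ.erase i, N x (σ j) j) • N' (σ i) i) x :=
    HasFDerivAt.fun_sum fun σ _ => (hprod σ).const_mul _
  have e1 : (fun y => Matrix.det (Matrix.of (N y))) =
      fun y => ∑ σ : Equiv.Perm n, (σ.sign : ℝ) * ∏ i, N y (σ i) i := by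
    ext y
    rw [Matrix.det_apply']
    rfl
  rw [e1]
  convert hsum using 1
  rw [Finset.sum_eq_single (1 : Equiv.Perm n)]
  · simp [h1]
  · intro σ _ hσ
    rw [Finset.sum_eq_zero, smul_zero]
    intro i _
    -- A nontrivial permutation moves at least two points, so an off-diagonal factor, zero at `x`,
    -- remains after removing the factor of index `i`.
    obtain ⟨j, hj, hji⟩ : ∃ j, σ j ≠ j ∧ j ≠ i := by
      obtain ⟨k, hk⟩ : ∃ k, σ k ≠ k := by
        by_contra! h
        exact hσ (Equiv.ext h)
      by_cases hki : k = i
      · exact ⟨σ k, fun h => hk (σ.injective h), fun h => hk (h.trans hki.symm)⟩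
      · exact ⟨k, hk, hki⟩
    rw [Finset.prod_eq_zero (i := j) (by simp [hji]) (by rw [h1, if_neg hj]), zero_smul]
  · simp

section

variable {G : V → V →L[ℝ] V →L[ℝ] ℝ} {x : V}

/-- The logarithmic derivative of the riemannian density. -/
theorem hasFDerivAt_volDensity {n : Type*} [Fintype n] [DecidableEq n] (hG : IsMetricAt G x)
    {e : Module.Basis n ℝ V} (he : ∀ i j, G x (e i) (e j) = if i = j then 1 else 0) :
    0 < volDensity G x ∧ ∃ D : V →L[ℝ] ℝ, HasFDerivAt (volDensity G) D x ∧
      ∀ w, D w = volDensity G x * ((1 / 2) * ∑ i, fderiv ℝ G x w (e i) (e i)) := by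
  let b := Module.finBasis ℝ V
  let e' := e.reindex (Fintype.equivOfCardEq (β := Fin (Module.finrank ℝ V))
    (by rw [← Module.finrank_eq_card_basis e, Fintype.card_fin]))
  let A : Matrix (Fin (Module.finrank ℝ V)) (Fin (Module.finrank ℝ V)) ℝ := e'.toMatrix b
  have he' : ∀ i j, G x (e' i) (e' j) = if i = j then 1 else 0 := by
    intro i j
    simp [e', he]
  let N : V → Fin (Module.finrank ℝ V) → Fin (Module.finrank ℝ V) → ℝ :=
    fun y i j => G y (e' i) (e' j)
  -- Changing basis multiplies the Gram determinant by a constant, so the density can be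
  -- differentiated in the basis where the Gram matrix is the identity at `x`.
  have hdet : ∀ y, Matrix.det (Matrix.of fun i j => G y (b i) (b j)) =
      A.det ^ 2 * Matrix.det (Matrix.of (N y)) := by
    intro y
    have : (Matrix.of fun i j => G y (b i) (b j)) = A.transpose * Matrix.of (N y) * A := by
      ext i j
      conv_lhs =>
        rw [Matrix.of_apply, ← e'.sum_repr (b i), ← e'.sum_repr (b j)]
      simp only [Matrix.mul_apply, Matrix.transpose_apply, Matrix.of_apply, map_sum, map_smul,
        sum_apply, smul_apply, smul_eq_mul, Finset.sum_mul, A, N, Module.Basis.toMatrix_apply]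
      refine Finset.sum_congr rfl fun k _ => ?_
      rw [Finset.mul_sum]
      refine Finset.sum_congr rfl fun l _ => ?_
      ring
    rw [this, Matrix.det_mul, Matrix.det_mul, Matrix.det_transpose]
    ring
  have hA : A.det ≠ 0 := by
    have := Matrix.det_ne_zero_of_left_inverse (A := A) (B := b.toMatrix e')
      (Module.Basis.toMatrix_mul_toMatrix_flip b e')
    exact this
  have hN1 : Matrix.det (Matrix.of (N x)) = 1 := by
    have : Matrix.of (N x) = 1 := by
      ext i j
      simp [N, he', Matrix.one_apply]
    rw [this, Matrix.det_one]
  have hNd : ∀ i j, HasFDerivAt (fun y => N y i j)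
      (((ContinuousLinearMap.apply ℝ ℝ (e' j)).comp
        (ContinuousLinearMap.apply ℝ _ (e' i))).comp (fderiv ℝ G x)) x := fun i j =>
    ((ContinuousLinearMap.apply ℝ ℝ (e' j)).comp
      (ContinuousLinearMap.apply ℝ _ (e' i))).hasFDerivAt.comp x hG.differentiableAt.hasFDerivAt
  have hD := hasFDerivAt_det_comp hNd he'
  have hval : volDensity G x = √(A.det ^ 2) := by
    rw [volDensity, hdet, hN1, mul_one]
  have hpos : 0 < A.det ^ 2 := by positivity
  have hD2 := (hD.const_mul (A.det ^ 2)).sqrt (by rw [hN1, mul_one]; exact hpos.ne')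
  have hfun : volDensity G = fun y => √(A.det ^ 2 * Matrix.det (Matrix.of (N y))) := by
    ext y
    rw [volDensity, hdet]
  refine ⟨by rw [hval]; positivity, _, by rw [hfun]; exact hD2, fun w => ?_⟩
  have hs : ∑ i, fderiv ℝ G x w (e' i) (e' i) = ∑ i, fderiv ℝ G x w (e i) (e i) := by
    simp only [e', Module.Basis.reindex_apply]
    exact Equiv.sum_comp (Equiv.symm _) fun i => fderiv ℝ G x w (e i) (e i)
  rw [← hs, hval, hN1, mul_one]
  have hsq : √(A.det ^ 2) * √(A.det ^ 2) = A.det ^ 2 := Real.mul_self_sqrt hpos.le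
  have hne : √(A.det ^ 2) ≠ 0 := by positivity
  simp only [smul_apply, sum_apply, ContinuousLinearMap.comp_apply,
    ContinuousLinearMap.apply_apply, smul_eq_mul]
  field_simp
  rw [pow_two √(A.det ^ 2), hsq]

theorem trace_eq_sum {n : Type*} [Fintype n] [DecidableEq n] {B : V →L[ℝ] V →L[ℝ] ℝ}
    {e : Module.Basis n ℝ V} (he : ∀ i j, B (e i) (e j) = if i = j then 1 else 0)
    (A : V →L[ℝ] V) : LinearMap.trace ℝ V (A : V →ₗ[ℝ] V) = ∑ i, B (A (e i)) (e i) := by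
  rw [LinearMap.trace_eq_matrix_trace ℝ e, Matrix.trace]
  refine Finset.sum_congr rfl fun i _ => ?_
  rw [Matrix.diag_apply, LinearMap.toMatrix_apply, IsInner.repr_eq he]
  rfl

/-- For a riemannian immersion the sub-laplacian is the Laplace-Beltrami operator. -/
theorem IsIsometricAt.subLaplacian_eq {H : W → W →L[ℝ] W →L[ℝ] ℝ} {f : V → W}
    (h : IsIsometricAt G H f x) {u : V → ℝ} (hu : ContDiffAt ℝ 2 u x) (B : ℝ →L[ℝ] ℝ →L[ℝ] ℝ) :
    subLaplacian G H f u x = - tension G (fun _ => B) u x := by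
  have := FiniteDimensional.complete ℝ V
  obtain ⟨e, he⟩ := h.dom.isInner.exists_basis
  obtain ⟨hpos, D, hD, hD'⟩ := hasFDerivAt_volDensity h.dom he
  -- The isometry condition turns the sub-riemannian cometric into the inverse metric, so the field
  -- is the gradient of `u`.
  have hX : ∀ᶠ y in 𝓝 x, subCometric G H f y (fderiv ℝ u y) = (G y).inverse (fderiv ℝ u y) := by
    filter_upwards [h.eventually] with y hy
    rw [subCometric]
    congr 1
    ext v
    rw [ContinuousLinearMap.comp_apply, hy.inner_eq, hy.dom.isInner.apply_inverse]
  set X : V → V := fun y => (G y).inverse (fderiv ℝ u y) with hXdef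
  have hi : DifferentiableAt ℝ (fun y => (G y).inverse) x :=
    ((h.dom.isInner.isInvertible.contDiffAt_map_inverse (n := 1)).comp x
      (h.dom.contDiffAt.of_le (by norm_num))).differentiableAt (by norm_num)
  have hXd : DifferentiableAt ℝ X x := hi.clm_apply (differentiableAt_fderiv hu)
  have e1 : (fun y => volDensity G y • subCometric G H f y (fderiv ℝ u y)) =ᶠ[𝓝 x]
      fun y => volDensity G y • X y := by
    filter_upwards [hX] with y hy
    rw [hy]
  -- Differentiating `G(X) = du` avoids a formula for the derivative of the inverse metric.
  have hdX (w v : V) : G x (fderiv ℝ X x w) v =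
      fderiv ℝ (fderiv ℝ u) x w v - fderiv ℝ G x w (X x) v := by
    have k1 := (h.dom.differentiableAt.hasFDerivAt.clm_apply hXd.hasFDerivAt)
    have k2 : (fun y => G y (X y)) =ᶠ[𝓝 x] fderiv ℝ u := by
      filter_upwards [h.dom.inner] with y hy using hy.apply_inverse _
    have k3 := DFunLike.congr_fun (DFunLike.congr_fun
      (k1.unique ((differentiableAt_fderiv hu).hasFDerivAt.congr_of_eventuallyEq k2)) w) v
    simp at k3
    linarith
  have hdu (v : V) : fderiv ℝ u x v = G x (X x) v := by
    rw [hXdef, h.dom.isInner.apply_inverse]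
  have htr := trace_eq_sum he
    (fderiv ℝ (fun y => volDensity G y • subCometric G H f y (fderiv ℝ u y)) x)
  rw [subLaplacian, htr, tension_eq_sum he hu, e1.fderiv_eq]
  have hprod := (hD.smul hXd.hasFDerivAt).fderiv
  have hprod' (w : V) : fderiv ℝ (fun y => volDensity G y • X y) x w =
      volDensity G x • fderiv ℝ X x w + D w • X x := by
    refine (DFunLike.congr_fun hprod w).trans ?_
    simp
  have hDX : D (X x) = ∑ i, D (e i) * G x (X x) (e i) := by
    conv_lhs => rw [← e.sum_repr (X x)]
    simp only [map_sum, map_smul, smul_eq_mul, IsInner.repr_eq he]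
    exact Finset.sum_congr rfl fun i _ => by ring
  have hmain : ∑ i, G x (fderiv ℝ (fun y => volDensity G y • X y) x (e i)) (e i) =
      volDensity G x * ∑ i, hess G (fun _ => B) u x (e i) (e i) := by
    simp only [hprod', map_add, map_smul, add_apply, smul_apply,
      smul_eq_mul, Finset.sum_add_distrib, ← Finset.mul_sum]
    rw [← hDX, hD', ← mul_add]
    congr 1
    rw [Finset.mul_sum, ← Finset.sum_add_distrib]
    -- By Koszul, `du(Γ(eᵢ, eᵢ)) = DG(eᵢ)(eᵢ, X) - ½ DG(X)(eᵢ, eᵢ)`: the first part comes from the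
    -- derivative of `X`, the second from that of the density.
    refine Finset.sum_congr rfl fun i _ => ?_
    rw [hess_eq hu, hessCLM_apply, hdX, christoffelCLM_const,
      hdu (christoffelCLM G x (e i) (e i)), h.dom.isInner.symm (X x),
      apply_christoffel h.dom.isInner, h.dom.fderiv_symm (e i) (X x)]
    simp only [Pi.zero_apply, zero_apply]
    ring
  rw [hmain, ← mul_assoc, inv_mul_cancel₀ hpos.ne', one_mul]

end

end LocalGeometry

/-! ### From manifolds to charts. -/

namespace ManifoldGeometry

open LocalGeometry

variable {V : Type*} [NormedAddCommGroup V] [NormedSpace ℝ V] [FiniteDimensional ℝ V]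
variable {M : Type*} [TopologicalSpace M] [ChartedSpace V M] [IsManifold 𝓘(ℝ, V) ∞ M]
variable {W : Type*} [NormedAddCommGroup W] [NormedSpace ℝ W] [FiniteDimensional ℝ W]
variable {N : Type*} [TopologicalSpace N] [ChartedSpace W N] [IsManifold 𝓘(ℝ, W) ∞ N]
variable {X : Type*} [NormedAddCommGroup X] [NormedSpace ℝ X] [FiniteDimensional ℝ X]
variable {F : Type*} [NormedAddCommGroup F] [InnerProductSpace ℝ F] [FiniteDimensional ℝ F]

/-- The metric at a point, as a bilinear form on the model space. -/
def metricInner (g : SmoothMetric V M) (q : M) : V →L[ℝ] V →L[ℝ] ℝ := g.inner q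

variable (V) in
/-- The derivative of a map from a vector space to a manifold, as a map to the model space. -/
noncomputable def mderiv (σ : X → M) (x : X) : X →L[ℝ] V := mfderiv 𝓘(ℝ, X) 𝓘(ℝ, V) σ x

theorem localMetric_apply (g : SmoothMetric V M) (p : M) (x u v : V) :
    localMetric g p x u v = metricInner g ((chartAt V p).symm x)
      (mderiv V (chartAt V p).symm x u) (mderiv V (chartAt V p).symm x v) := rfl

theorem mderiv_congr {σ σ' : X → M} {x : X} (h : σ =ᶠ[𝓝 x] σ') :
    mderiv V σ x = mderiv V σ' x := h.mfderiv_eq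

theorem mdifferentiableAt_chart_symm (p : M) {x : V} (hx : x ∈ (chartAt V p).target) :
    MDifferentiableAt 𝓘(ℝ, V) 𝓘(ℝ, V) (chartAt V p).symm x :=
  (mdifferentiable_chart (I := 𝓘(ℝ, V)) p).mdifferentiableAt_symm hx

theorem mdifferentiableAt_chart (p : M) {q : M} (hq : q ∈ (chartAt V p).source) :
    MDifferentiableAt 𝓘(ℝ, V) 𝓘(ℝ, V) (chartAt V p) q :=
  (mdifferentiable_chart (I := 𝓘(ℝ, V)) p).mdifferentiableAt hq

theorem mderiv_chart_symm_comp {p : M} {τ : X → V} {x : X} (hτ : DifferentiableAt ℝ τ x)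
    (hx : τ x ∈ (chartAt V p).target) (u : X) :
    mderiv V (fun y => (chartAt V p).symm (τ y)) x u =
      mderiv V (chartAt V p).symm (τ x) (fderiv ℝ τ x u) := by
  have := mfderiv_comp x (mdifferentiableAt_chart_symm p hx) hτ.mdifferentiableAt
  rw [mfderiv_eq_fderiv] at this
  exact DFunLike.congr_fun this u

theorem mderiv_chart_symm_injective {p : M} {x : V} (hx : x ∈ (chartAt V p).target) :
    Function.Injective (mderiv V (chartAt V p).symm x) := by
  exact (mdifferentiable_chart (I := 𝓘(ℝ, V)) p).symm.mfderiv_injective hx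

theorem differentiableAt_chart_comp {p : M} {σ : X → M} {x : X}
    (hσ : MDifferentiableAt 𝓘(ℝ, X) 𝓘(ℝ, V) σ x) (hx : σ x ∈ (chartAt V p).source) :
    DifferentiableAt ℝ (fun y => chartAt V p (σ y)) x :=
  ((mdifferentiableAt_chart p hx).comp x hσ).differentiableAt

theorem eventually_chart_symm_chart {p : M} {σ : X → M} {x : X}
    (hσ : ContinuousAt σ x) (hx : σ x ∈ (chartAt V p).source) :
    (fun y => (chartAt V p).symm (chartAt V p (σ y))) =ᶠ[𝓝 x] σ := by
  filter_upwards [hσ.eventually ((chartAt V p).open_source.mem_nhds hx)] with y hy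
  exact (chartAt V p).left_inv hy

theorem metricInner_symm (g : SmoothMetric V M) (q : M) (u v : V) :
    metricInner g q u v = metricInner g q v u := g.symm q u v

theorem metricInner_pos (g : SmoothMetric V M) (q : M) {u : V} (hu : u ≠ 0) :
    0 < metricInner g q u u := g.pos q u hu

/-- The local metric in the coordinates of a chart around `σ x`. -/
theorem localMetric_fderiv (g : SmoothMetric V M) {p : M} {σ : X → M} {x : X}
    (hσ : MDifferentiableAt 𝓘(ℝ, X) 𝓘(ℝ, V) σ x) (hx : σ x ∈ (chartAt V p).source) (u v : X) :
    localMetric g p (chartAt V p (σ x)) (fderiv ℝ (fun y => chartAt V p (σ y)) x u)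
      (fderiv ℝ (fun y => chartAt V p (σ y)) x v) =
      metricInner g (σ x) (mderiv V σ x u) (mderiv V σ x v) := by
  have hd := differentiableAt_chart_comp hσ hx
  have ht := (chartAt V p).map_source hx
  rw [localMetric_apply, ← mderiv_chart_symm_comp hd ht, ← mderiv_chart_symm_comp hd ht,
    mderiv_congr (eventually_chart_symm_chart hσ.continuousAt hx), (chartAt V p).left_inv hx]

/-- In finite dimension regularity can be tested on fixed vectors; this reduces the regularity of
the metric coefficients to scalar functions. -/
theorem contDiffAt_of_forall_apply {k : X → V →L[ℝ] W} {n : WithTop ℕ∞} {x : X}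
    (h : ∀ u, ContDiffAt ℝ n (fun y => k y u) x) : ContDiffAt ℝ n k x := by
  have := FiniteDimensional.complete ℝ V
  let b := Module.finBasis ℝ V
  have e : k = fun y => ∑ i, (ContinuousLinearMap.smulRightL ℝ V W
      (LinearMap.toContinuousLinearMap (b.coord i))) (k y (b i)) := by
    ext y v
    conv_lhs => rw [← b.sum_repr v]
    simp only [map_sum, map_smul, sum_apply]
    rfl
  rw [e]
  exact ContDiffAt.sum fun i _ => (ContinuousLinearMap.contDiff _).contDiffAt.comp x (h (b i))

/-- The coefficients are the smooth section `g` evaluated on coordinate fields, which are the images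
of constant fields under the tangent map of the inverse chart. -/
theorem contDiffAt_localMetric (g : SmoothMetric V M) {p : M} {x : V}
    (hx : x ∈ (chartAt V p).target) : ContDiffAt ℝ 2 (localMetric g p) x := by
  refine contDiffAt_of_forall_apply fun u => contDiffAt_of_forall_apply fun v => ?_
  have ho := (chartAt V p).open_target
  have hs : ContMDiffOn 𝓘(ℝ, V) 𝓘(ℝ, V) ∞ (chartAt V p).symm (chartAt V p).target :=
    contMDiffOn_chart_symm
  have hsec (u : V) : ContMDiffAt 𝓘(ℝ, V) (𝓘(ℝ, V).prod 𝓘(ℝ, V)) 2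
      (fun y => (⟨(chartAt V p).symm y, mfderiv 𝓘(ℝ, V) 𝓘(ℝ, V) (chartAt V p).symm y u⟩ :
        TangentBundle 𝓘(ℝ, V) M)) x := by
    have h1 := hs.contMDiffOn_tangentMapWithin (m := 2) (by norm_cast) ho.uniqueMDiffOn
    have h2 : ContMDiff 𝓘(ℝ, V) (𝓘(ℝ, V).prod 𝓘(ℝ, V)) 2
        (fun y => (⟨y, u⟩ : TangentBundle 𝓘(ℝ, V) V)) := by
      intro y
      refine Bundle.contMDiffAt_totalSpace.mpr ⟨contMDiffAt_id, ?_⟩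
      simpa using contMDiffAt_const
    have h3 := (h1.contMDiffAt (x := ⟨x, u⟩)
      ((ho.preimage (FiberBundle.continuous_proj V _)).mem_nhds hx)).comp x h2.contMDiffAt
    refine h3.congr_of_eventuallyEq ?_
    filter_upwards [ho.mem_nhds hx] with y hy
    simp only [Function.comp_apply, tangentMapWithin]
    rw [mfderivWithin_of_isOpen ho hy]
  have key : ContMDiffAt 𝓘(ℝ, V) (𝓘(ℝ, V).prod 𝓘(ℝ, ℝ)) 2
      (fun y => Bundle.TotalSpace.mk' ℝ (E := Bundle.Trivial M ℝ) ((chartAt V p).symm y)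
        (g.inner ((chartAt V p).symm y) (mfderiv 𝓘(ℝ, V) 𝓘(ℝ, V) (chartAt V p).symm y u)
          (mfderiv 𝓘(ℝ, V) 𝓘(ℝ, V) (chartAt V p).symm y v))) x := by
    apply ContMDiffAt.clm_bundle_apply₂ (F₁ := V) (F₂ := V)
    · exact (g.contMDiff.of_le (by norm_cast)).contMDiffAt.comp x
        ((hs.contMDiffAt (ho.mem_nhds hx)).of_le (by norm_cast))
    · exact hsec u
    · exact hsec v
  rw [Bundle.contMDiffAt_totalSpace] at key
  exact key.2.contDiffAt

theorem isMetricAt_localMetric (g : SmoothMetric V M) {p : M} {x : V}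
    (hx : x ∈ (chartAt V p).target) : IsMetricAt (localMetric g p) x := by
  refine ⟨contDiffAt_localMetric g hx, ?_⟩
  filter_upwards [(chartAt V p).open_target.mem_nhds hx] with y hy
  refine ⟨fun u v => ?_, fun u hu => ?_⟩
  · rw [localMetric_apply, localMetric_apply, metricInner_symm]
  · rw [localMetric_apply]
    exact metricInner_pos g _ fun h =>
      hu (mderiv_chart_symm_injective hy (h.trans (map_zero _).symm))

/-- The preferred chart of a vector space is the identity. -/
theorem localMetric_euclideanMetric (q : F) :
    localMetric (euclideanMetric F) q = fun _ => euclideanInner F := by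
  ext x u v
  have h : mderiv F (chartAt F q).symm x = ContinuousLinearMap.id ℝ F := by
    have : mfderiv 𝓘(ℝ, F) 𝓘(ℝ, F) (id : F → F) x = ContinuousLinearMap.id ℝ F := mfderiv_id
    exact this
  rw [localMetric_apply, h]
  rfl

section

variable {φ : M → N} {p : M}

theorem localMap_chart (φ : M → N) (p : M) :
    localMap (V := V) (W := W) φ p (chartAt V p p) = chartAt W (φ p) (φ p) := by
  simp [localMap]

theorem chart_mem_target (p : M) : chartAt V p p ∈ (chartAt V p).target :=
  (chartAt V p).map_source (mem_chart_source V p)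

theorem contDiffAt_chart_comp {n : WithTop ℕ∞} (hn : n ≤ ∞) {σ : X → M} {x : X}
    (hσ : ContMDiffAt 𝓘(ℝ, X) 𝓘(ℝ, V) n σ x) {q : M} (hx : σ x ∈ (chartAt V q).source) :
    ContDiffAt ℝ n (fun y => chartAt V q (σ y)) x :=
  (((contMDiffOn_chart (I := 𝓘(ℝ, V)) (n := ∞) (x := q)).contMDiffAt
    ((chartAt V q).open_source.mem_nhds hx)).of_le hn |>.comp x hσ).contDiffAt

theorem contMDiffAt_chart_symm {n : WithTop ℕ∞} (hn : n ≤ ∞) {q : M} {x : V}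
    (hx : x ∈ (chartAt V q).target) :
    ContMDiffAt 𝓘(ℝ, V) 𝓘(ℝ, V) n (chartAt V q).symm x :=
  ((contMDiffOn_chart_symm (I := 𝓘(ℝ, V)) (n := ∞) (x := q)).contMDiffAt
    ((chartAt V q).open_target.mem_nhds hx)).of_le hn

theorem contDiffAt_localMap {n : WithTop ℕ∞} (hn : n ≤ ∞)
    (hφ : ContMDiffAt 𝓘(ℝ, V) 𝓘(ℝ, W) n φ p) :
    ContDiffAt ℝ n (localMap φ p : V → W) (chartAt V p p) := by
  have hp := (chartAt V p).left_inv (mem_chart_source V p)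
  refine contDiffAt_chart_comp hn (σ := φ ∘ (chartAt V p).symm) ?_ ?_
  · refine ContMDiffAt.comp _ ?_ (contMDiffAt_chart_symm hn (chart_mem_target p))
    rwa [hp]
  · simp [hp]

theorem eventually_localMap_chart (hφ : ContinuousAt φ p) :
    ∀ᶠ y in 𝓝 (chartAt V p p), y ∈ (chartAt V p).target ∧
      φ ((chartAt V p).symm y) ∈ (chartAt W (φ p)).source := by
  have hp := (chartAt V p).left_inv (mem_chart_source V p)
  have hc : ContinuousAt (φ ∘ (chartAt V p).symm) (chartAt V p p) := by
    refine ContinuousAt.comp ?_ ((chartAt V p).continuousAt_symm (chart_mem_target p))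
    rwa [hp]
  refine Filter.Eventually.and ((chartAt V p).open_target.mem_nhds (chart_mem_target p)) ?_
  refine hc.eventually ((chartAt W (φ p)).open_source.mem_nhds ?_)
  simp [hp]

theorem mfderiv_eq_fderiv_localMap (hφ : MDifferentiableAt 𝓘(ℝ, V) 𝓘(ℝ, W) φ p) :
    mfderiv 𝓘(ℝ, V) 𝓘(ℝ, W) φ p =
      (fderiv ℝ (localMap φ p : V → W) (chartAt V p p) : V →L[ℝ] W) := by
  refine hφ.mfderiv.trans ?_
  simp only [writtenInExtChartAt, mfld_simps, fderivWithin_univ]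
  rfl

/-- The chain rule carries `φ^*h = g` to the charts; the coordinate results on immersions then apply
to `γ` and `ι`. -/
theorem isIsometricAt_localMap {g : SmoothMetric V M} {h : SmoothMetric W N}
    (hφ : IsRiemannianImmersion g h φ) (p : M) :
    IsIsometricAt (localMetric g p) (localMetric h (φ p)) (localMap φ p) (chartAt V p p) := by
  refine ⟨(contDiffAt_localMap le_rfl hφ.1.contMDiffAt).of_le (by norm_cast),
    isMetricAt_localMetric g (chart_mem_target p), ?_, ?_⟩
  · rw [localMap_chart]
    exact isMetricAt_localMetric h (chart_mem_target _)
  · filter_upwards [eventually_localMap_chart (V := V) (W := W)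
      hφ.1.continuous.continuousAt] with y hy u v
    have h1 := mdifferentiableAt_chart_symm p hy.1
    have h2 : MDifferentiableAt 𝓘(ℝ, V) 𝓘(ℝ, W) φ ((chartAt V p).symm y) :=
      hφ.1.mdifferentiableAt (by simp)
    have h3 := localMetric_fderiv h (σ := φ ∘ (chartAt V p).symm) (h2.comp y h1) hy.2 u v
    refine h3.trans ?_
    have h4 (w : V) : mderiv W (φ ∘ (chartAt V p).symm) y w =
        mfderiv 𝓘(ℝ, V) 𝓘(ℝ, W) φ ((chartAt V p).symm y) (mderiv V (chartAt V p).symm y w) :=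
      DFunLike.congr_fun (mfderiv_comp y h2 h1) w
    rw [h4, h4]
    exact hφ.2 _ _ _

end

end ManifoldGeometry

/-! ### Smoothness of the projection by the implicit function theorem. -/

namespace LocalGeometry

variable {V : Type*} [NormedAddCommGroup V] [NormedSpace ℝ V] [FiniteDimensional ℝ V]
variable {W : Type*} [NormedAddCommGroup W] [NormedSpace ℝ W] [FiniteDimensional ℝ W]
variable {F : Type*} [NormedAddCommGroup F] [InnerProductSpace ℝ F] [FiniteDimensional ℝ F]

/-- A continuous solution of the critical point equation of the distance is smooth. -/
theorem contDiffAt_of_critical {G : V → V →L[ℝ] V →L[ℝ] ℝ} {f : V → F} {P : F → V} {x : V}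
    (h : IsIsometricAt G (fun _ => euclideanInner F) f x) (hf : ContDiffAt ℝ 4 f x)
    (hP : Tendsto P (𝓝 (f x)) (𝓝 x))
    (hc : ∀ᶠ y in 𝓝 (f x), ∀ v, euclideanInner F (y - f (P y)) (fderiv ℝ f (P y) v) = 0) :
    ContDiffAt ℝ 3 P (f x) := by
  have := FiniteDimensional.complete ℝ V
  have := FiniteDimensional.complete ℝ (V →L[ℝ] ℝ)
  -- `Φ(y, z) = 0` says that `y - f z` is normal at `z`. It involves `df`, hence `C⁴` for `f` and
  -- `C³` for the projection.
  let Φ : F × V → (V →L[ℝ] ℝ) := fun z =>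
    (euclideanInner F (z.1 - f z.2)).comp (fderiv ℝ f z.2)
  have hΦ : ContDiffAt ℝ 3 Φ (f x, x) := by
    have h1 : ContDiffAt ℝ 3 (fun z : F × V => f z.2) (f x, x) :=
      (hf.of_le (by norm_num)).comp (f x, x) contDiffAt_snd
    have h2 : ContDiffAt ℝ 3 (fun z : F × V => fderiv ℝ f z.2) (f x, x) :=
      (hf.fderiv_right (m := 3) (by norm_num)).comp (f x, x) contDiffAt_snd
    exact ((euclideanInner F).contDiff.contDiffAt.comp (f x, x)
      (contDiffAt_fst.sub h1)).clm_comp h2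
  -- The term with the second derivative of `f` is paired with `f x - f x = 0`, so the partial
  -- derivative is minus the metric.
  have hpart : (fderiv ℝ Φ (f x, x)).comp (ContinuousLinearMap.inr ℝ F V) = - G x := by
    have hd : HasFDerivAt (fun x' : V => ((f x, x') : F × V)) (ContinuousLinearMap.inr ℝ F V) x :=
      hasFDerivAt_prodMk_right (f x) x
    have h1 : HasFDerivAt (fun x' => Φ (f x, x'))
        ((fderiv ℝ Φ (f x, x)).comp (ContinuousLinearMap.inr ℝ F V)) x :=
      (hΦ.differentiableAt (by norm_num)).hasFDerivAt.comp x hd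
    have h2 := ((euclideanInner F).hasFDerivAt.comp x
      ((hasFDerivAt_const (f x) x).sub h.differentiableAt.hasFDerivAt)).clm_comp
      (differentiableAt_fderiv h.contDiffAt_two).hasFDerivAt
    have h3 := h1.unique h2
    rw [h3]
    ext u v
    have := h.inner_eq u v
    simp [← this]
  have hinv : ((fderiv ℝ Φ (f x, x)).comp (ContinuousLinearMap.inr ℝ F V)).IsInvertible := by
    rw [hpart]
    obtain ⟨e, he⟩ := h.dom.isInner.isInvertible
    exact ⟨e.trans (ContinuousLinearEquiv.neg ℝ), by rw [← he]; rfl⟩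
  have hs := hΦ.contDiffAt_implicitFunction (by norm_num) hinv
  -- Solutions near `(f x, x)` are unique, so `P`, which tends to `x`, agrees with the implicit
  -- function.
  refine hs.congr_of_eventuallyEq ?_
  have ht : Tendsto (fun y => (y, P y)) (𝓝 (f x)) (𝓝 (f x, x)) := by
    rw [nhds_prod_eq]
    exact tendsto_id.prodMk hP
  filter_upwards [ht.eventually (hΦ.eventually_apply_eq_iff_implicitFunction (by norm_num) hinv),
    hc] with y h1 h2
  refine (h1.mp ?_).symm
  ext v
  simpa [Φ] using h2 v

theorem inner_eq_zero_of_isLocalMin {f : V → F} {x : V} {y : F} (hf : DifferentiableAt ℝ f x)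
    (hm : IsLocalMin (fun z => ‖y - f z‖) x) (v : V) :
    euclideanInner F (y - f x) (fderiv ℝ f x v) = 0 := by
  -- The squared distance is differentiable even where the distance is zero.
  have hm2 : IsLocalMin (fun z => ‖y - f z‖ ^ 2) x := by
    filter_upwards [hm] with z hz
    gcongr
  have hd := ((hasFDerivAt_const y x).sub hf.hasFDerivAt).norm_sq
  have := DFunLike.congr_fun (hm2.hasFDerivAt_eq_zero hd) v
  simp only [euclideanInner_apply, inner_sub_left]
  simp at this
  linarith

end LocalGeometry

/-! ### The nearest-point projection and the formula for the curvature term. -/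

namespace ManifoldGeometry

open LocalGeometry

variable {V : Type*} [NormedAddCommGroup V] [NormedSpace ℝ V] [FiniteDimensional ℝ V]
variable {M : Type*} [TopologicalSpace M] [ChartedSpace V M] [IsManifold 𝓘(ℝ, V) ∞ M]
variable {W : Type*} [NormedAddCommGroup W] [NormedSpace ℝ W] [FiniteDimensional ℝ W]
variable {N : Type*} [TopologicalSpace N] [ChartedSpace W N] [IsManifold 𝓘(ℝ, W) ∞ N]
variable {X : Type*} [NormedAddCommGroup X] [NormedSpace ℝ X] [FiniteDimensional ℝ X]
variable {F : Type*} [NormedAddCommGroup F] [InnerProductSpace ℝ F] [FiniteDimensional ℝ F]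

section

variable {Θ : Type*} [TopologicalSpace Θ] [CompactSpace Θ] [Nonempty Θ]

/-- Compactness provides a minimiser, so the choice made by `Classical.epsilon` is one. -/
theorem norm_sub_nearestPoint_le {ι : Θ → F} (hι : Continuous ι) (y : F) (q : Θ) :
    ‖y - ι (nearestPoint ι y)‖ ≤ ‖y - ι q‖ := by
  have hex : ∃ p, ∀ q, ‖y - ι p‖ ≤ ‖y - ι q‖ := by
    obtain ⟨p, -, hp⟩ := isCompact_univ.exists_isMinOn (univ_nonempty (α := Θ))
      (f := fun q => ‖y - ι q‖) (by fun_prop)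
    exact ⟨p, fun q => hp (mem_univ q)⟩
  exact Classical.epsilon_spec hex q

theorem nearestPoint_apply {ι : Θ → F} (hι : IsEmbedding ι) (p : Θ) :
    nearestPoint ι (ι p) = p := by
  have := norm_sub_nearestPoint_le hι.continuous (ι p) p
  rw [sub_self, norm_zero] at this
  exact (hι.injective (sub_eq_zero.mp (norm_le_zero_iff.mp this))).symm

/-- By minimality and the triangle inequality, `‖ι(π y) - ι p‖ ≤ 2 ‖y - ι p‖`. As `ι` is an
embedding this gives convergence in the source, whichever nearest points are chosen. -/
theorem tendsto_nearestPoint {ι : Θ → F} (hι : IsEmbedding ι) (p : Θ) :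
    Tendsto (nearestPoint ι) (𝓝 (ι p)) (𝓝 p) := by
  rw [hι.nhds_eq_comap, tendsto_comap_iff, tendsto_iff_norm_sub_tendsto_zero]
  have h0 : Tendsto (fun y => 2 * ‖y - ι p‖) (𝓝 (ι p)) (𝓝 0) := by
    have : Continuous fun y => 2 * ‖y - ι p‖ := by fun_prop
    simpa using this.tendsto (ι p)
  refine squeeze_zero (fun _ => norm_nonneg _) (fun y => ?_) h0
  have h1 := norm_sub_nearestPoint_le hι.continuous y p
  have h2 : (ι ∘ nearestPoint ι) y - ι p = (y - ι p) - (y - ι (nearestPoint ι y)) := by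
    simp
  rw [h2]
  linarith [norm_sub_le (y - ι p) (y - ι (nearestPoint ι y))]

variable [ChartedSpace V Θ] [IsManifold 𝓘(ℝ, V) ∞ Θ]

theorem localMap_eq_comp_chart_symm (ι : Θ → F) (p : Θ) :
    (localMap ι p : V → F) = ι ∘ (chartAt V p).symm := rfl

/-- The nearest point projection is the orthogonal projection, in coordinates. -/
theorem isProjectionAt_nearestPoint {g : SmoothMetric V Θ} {ι : Θ → F} (hι : IsEmbedding ι)
    (hι' : IsRiemannianImmersion g (euclideanMetric F) ι) (p : Θ) :
    IsProjectionAt (localMetric g p) (localMap ι p) (fun y => chartAt V p (nearestPoint ι y))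
      (chartAt V p p) := by
  have hiso := isIsometricAt_localMap hι' p
  rw [localMetric_euclideanMetric] at hiso
  have hp : (localMap ι p : V → F) (chartAt V p p) = ι p := by
    simp [localMap_eq_comp_chart_symm]
  have hsrc := (chartAt V p).open_source.mem_nhds (mem_chart_source V p)
  have ht : Tendsto (fun y => chartAt V p (nearestPoint ι y))
      (𝓝 ((localMap ι p : V → F) (chartAt V p p))) (𝓝 (chartAt V p p)) := by
    rw [hp]
    exact ((chartAt V p).continuousAt (mem_chart_source V p)).tendsto.comp
      (tendsto_nearestPoint hι p)
  have hc : ∀ᶠ y in 𝓝 ((localMap ι p : V → F) (chartAt V p p)), ∀ v,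
      euclideanInner F (y - (localMap ι p : V → F) (chartAt V p (nearestPoint ι y)))
        (fderiv ℝ (localMap ι p) (chartAt V p (nearestPoint ι y)) v) = 0 := by
    have hsrc' : ∀ᶠ y in 𝓝 ((localMap ι p : V → F) (chartAt V p p)),
        nearestPoint ι y ∈ (chartAt V p).source := by
      rw [hp]
      exact (tendsto_nearestPoint hι p).eventually hsrc
    filter_upwards [ht.eventually hiso.eventually, hsrc'] with y h1 h2
    refine inner_eq_zero_of_isLocalMin h1.differentiableAt (Filter.Eventually.of_forall fun z => ?_)
    simp only [localMap_eq_comp_chart_symm, Function.comp_apply, (chartAt V p).left_inv h2]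
    exact norm_sub_nearestPoint_le hι.continuous y _
  refine ⟨hiso, ?_, ?_, hc⟩
  · exact contDiffAt_of_critical hiso
      ((contDiffAt_localMap le_rfl hι'.1.contMDiffAt).of_le (by norm_cast)) ht hc
  · rw [hp, nearestPoint_apply hι]

/-- Near `ι p` the nearest point stays in the chart at `p`, through which the composite can be
factored. -/
theorem localMap_comp_nearestPoint {γ : Θ → N} {ι : Θ → F}
    (hι : IsEmbedding ι) (p : Θ) :
    (localMap (γ ∘ nearestPoint ι) (ι p) : F → W) =ᶠ[𝓝 (ι p)]
      (localMap γ p : V → W) ∘ fun y => chartAt V p (nearestPoint ι y) := by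
  have hsrc := (chartAt V p).open_source.mem_nhds (mem_chart_source V p)
  filter_upwards [(tendsto_nearestPoint hι p).eventually hsrc] with y hy
  simp only [localMap, Function.comp_apply, nearestPoint_apply hι, (chartAt V p).left_inv hy]
  rfl

theorem ricci_congr {G : X → X →L[ℝ] X →L[ℝ] ℝ} {H : W → W →L[ℝ] W →L[ℝ] ℝ} {f k : X → W}
    {x : X} (h : f =ᶠ[𝓝 x] k) : ricci G H f x = ricci G H k x := by
  have h1 := hess_eventuallyEq (G := G) (H := H) h
  have h2 (v w : X) : (fun y => hess G H f y v w) =ᶠ[𝓝 x] fun y => hess G H k y v w := by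
    filter_upwards [h1] with y hy
    rw [hy]
  ext u
  simp only [ricci, curvature, hess₂, covDerivAlong, (h2 _ _).fderiv_eq, h.fderiv.eq_of_nhds,
    h.eq_of_nhds, (h2 _ _).eq_of_nhds]

theorem curvatureTerm_eq {g : SmoothMetric V Θ} {h : SmoothMetric W N} {ι : Θ → F}
    (hι : IsEmbedding ι) (hι' : IsRiemannianImmersion g (euclideanMetric F) ι) {γ : Θ → N}
    (hγ : IsRiemannianImmersion g h γ) (p : Θ) :
    curvatureTerm g h ι γ p =
      5 / 3 * normSqSecondFundamentalForm g (euclideanMetric F) ι p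
        - 2 / 3 * normSqTensionField g (euclideanMetric F) ι p
        - 1 / 6 * normSqSecondFundamentalForm g h γ p
        - 1 / 3 * normSqTensionField g h γ p := by
  have hP := isProjectionAt_nearestPoint hι hι' p
  have hk := isIsometricAt_localMap hγ p
  have hp : (localMap ι p : V → F) (chartAt V p p) = ι p := by
    simp [localMap_eq_comp_chart_symm]
  have h1 := normSqHess_comp_projection hP hk
  have h2 := innerDiff_ricci_comp_projection hP hk
  have h3 := hk.innerDiff_covDerivAlong_tension
  rw [hp] at h1 h2
  have e := localMap_comp_nearestPoint (V := V) (W := W) (γ := γ) hι p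
  have e1 : normSqSecondFundamentalForm (euclideanMetric F) h (γ ∘ nearestPoint ι) (ι p) =
      normSqHess (fun _ => euclideanInner F) (localMetric h (γ p))
        ((localMap γ p : V → W) ∘ fun y => chartAt V p (nearestPoint ι y)) (ι p) := by
    simp only [normSqSecondFundamentalForm, localMetric_euclideanMetric, Function.comp_apply,
      nearestPoint_apply hι]
    -- The chart of `F` is the identity, so the base point is `ι p` itself.
    change normSqHess _ _ _ (ι p) = _
    simp only [normSqHess, hess_congr e, e.eq_of_nhds]
  have e2 : innerDiffRicci (euclideanMetric F) h (γ ∘ nearestPoint ι) (ι p) =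
      innerDiff (fun _ => euclideanInner F) (localMetric h (γ p))
        ((localMap γ p : V → W) ∘ fun y => chartAt V p (nearestPoint ι y)) (ι p)
        (ricci (fun _ => euclideanInner F) (localMetric h (γ p))
          ((localMap γ p : V → W) ∘ fun y => chartAt V p (nearestPoint ι y)) (ι p)) := by
    simp only [innerDiffRicci, localMetric_euclideanMetric, Function.comp_apply,
      nearestPoint_apply hι]
    change innerDiff _ _ _ (ι p) (ricci _ _ _ (ι p)) = _
    rw [ricci_congr e]
    simp only [innerDiff, e.fderiv.eq_of_nhds, e.eq_of_nhds]
  rw [curvatureTerm, e1, e2, h1, h2, innerDiffNablaTension, h3]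
  simp only [normSqSecondFundamentalForm, normSqTensionField, localMetric_euclideanMetric]
  ring

end

theorem subLaplacian_eq_laplacian {g : SmoothMetric V M} {h : SmoothMetric W N} {γ : M → N}
    (hγ : IsRiemannianImmersion g h γ) {u : M → ℝ} (hu : ContMDiff 𝓘(ℝ, V) 𝓘(ℝ, ℝ) ∞ u) (p : M) :
    subLaplacian g h γ u p = laplacian g u p := by
  have h1 := (isIsometricAt_localMap hγ p).subLaplacian_eq
    ((contDiffAt_localMap (p := p) le_rfl hu.contMDiffAt).of_le (by norm_cast)) (euclideanInner ℝ)
  rw [laplacian, tensionField, localMetric_euclideanMetric]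
  exact h1

end ManifoldGeometry

/-! ### Geodesics in coordinates. -/

namespace LocalGeometry

variable {V : Type*} [NormedAddCommGroup V] [NormedSpace ℝ V] [FiniteDimensional ℝ V]
variable {W : Type*} [NormedAddCommGroup W] [NormedSpace ℝ W] [FiniteDimensional ℝ W]

/-- The acceleration `∇_{c'} c'` of a curve, in coordinates. -/
noncomputable def acceleration (G : V → V →L[ℝ] V →L[ℝ] ℝ) (c : ℝ → V) (t : ℝ) : V :=
  deriv (deriv c) t + christoffelCLM G (c t) (deriv c t) (deriv c t)

/-- Any constant form on the line has zero Christoffel symbols, even a degenerate one; later uses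
take `B = 0`. -/
theorem hess_curve (B : ℝ →L[ℝ] ℝ →L[ℝ] ℝ) (G : V → V →L[ℝ] V →L[ℝ] ℝ) (c : ℝ → V) (t : ℝ) :
    hess (fun _ => B) G c t 1 1 = acceleration G c t := by
  rw [hess, covDerivAlong, christoffel_eq, christoffel_eq, christoffelCLM_const]
  simp [acceleration]

theorem acceleration_congr {G : V → V →L[ℝ] V →L[ℝ] ℝ} {c c' : ℝ → V} {t : ℝ}
    (h : c =ᶠ[𝓝 t] c') : acceleration G c t = acceleration G c' t := by
  rw [← hess_curve 0, ← hess_curve 0, hess_congr h]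

theorem acceleration_comp (G : V → V →L[ℝ] V →L[ℝ] ℝ) (H : W → W →L[ℝ] W →L[ℝ] ℝ) {f : V → W}
    {c : ℝ → V} {t : ℝ} (hc : ContDiffAt ℝ 2 c t) (hf : ContDiffAt ℝ 2 f (c t)) :
    acceleration H (f ∘ c) t = hess G H f (c t) (deriv c t) (deriv c t)
      + fderiv ℝ f (c t) (acceleration G c t) := by
  rw [← hess_curve 0, hess_comp _ G H hc hf, hess_curve]
  simp

/-- The second fundamental form of a local isometry vanishes. -/
theorem IsIsometricAt.hess_eq_zero {G : V → V →L[ℝ] V →L[ℝ] ℝ} {H : W → W →L[ℝ] W →L[ℝ] ℝ}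
    {f : V → W} {x : V} (h : IsIsometricAt G H f x)
    (hs : Function.Surjective (fderiv ℝ f x)) (u v : V) : hess G H f x u v = 0 := by
  obtain ⟨w, hw⟩ := hs (hess G H f x u v)
  refine h.cod.isInner.eq_zero ?_
  have := h.hess_normal u v w
  rwa [hw] at this

/-- A geodesic in the target which is tangent to, and contained in, the image of a riemannian
immersion is a geodesic of the source. -/
theorem IsIsometricAt.hess_eq_zero_of_acceleration {G : V → V →L[ℝ] V →L[ℝ] ℝ}
    {H : W → W →L[ℝ] W →L[ℝ] ℝ} {f : V → W} {c : ℝ → V} {t : ℝ} (h : IsIsometricAt G H f (c t))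
    (hc : ContDiffAt ℝ 2 c t) (hacc : acceleration H (f ∘ c) t = 0) :
    hess G H f (c t) (deriv c t) (deriv c t) = 0 := by
  rw [acceleration_comp G H hc h.contDiffAt_two] at hacc
  have h1 : acceleration G c t = 0 := by
    refine h.dom.isInner.eq_zero ?_
    rw [← h.inner_eq]
    have := congrArg (fun w => H (f (c t)) w (fderiv ℝ f (c t) (acceleration G c t))) hacc
    simpa [h.hess_normal] using this
  simpa [h1] using hacc

/-- Polarisation of the symmetric form `∇df`. -/
theorem hess_eq_zero_of_diagonal {G : V → V →L[ℝ] V →L[ℝ] ℝ} {H : W → W →L[ℝ] W →L[ℝ] ℝ}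
    {f : V → W} {x : V} (h : IsIsometricAt G H f x) (hd : ∀ v, hess G H f x v v = 0) (u v : V) :
    hess G H f x u v = 0 := by
  simp only [hess_eq h.contDiffAt_two] at hd ⊢
  have h1 := hd (u + v)
  simp only [map_add, add_apply, hd, zero_add, add_zero] at h1
  rw [hessCLM_symm h.dom h.cod h.contDiffAt_two v u, ← two_smul ℝ, smul_eq_zero] at h1
  simpa using h1

/-- The geodesic vector field on the tangent bundle, in coordinates. -/
noncomputable def geodesicField (G : V → V →L[ℝ] V →L[ℝ] ℝ) (z : V × V) : V × V :=
  (z.2, - christoffelCLM G z.1 z.2 z.2)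

theorem contDiffAt_geodesicField {G : V → V →L[ℝ] V →L[ℝ] ℝ} {x : V} (h : IsMetricAt G x) (v : V) :
    ContDiffAt ℝ 1 (geodesicField G) (x, v) := by
  have h1 : ContDiffAt ℝ 1 (fun z : V × V => christoffelCLM G z.1) (x, v) :=
    (contDiffAt_christoffelCLM h).comp (x, v) contDiffAt_fst
  exact contDiffAt_snd.prodMk ((h1.clm_apply contDiffAt_snd).clm_apply contDiffAt_snd).neg

/-- Picard-Lindelöf for the first-order system on positions and velocities. -/
theorem exists_local_geodesic {G : V → V →L[ℝ] V →L[ℝ] ℝ} {x : V} (h : IsMetricAt G x) (v : V)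
    {U : Set V} (hU : U ∈ 𝓝 x) :
    ∃ c : ℝ → V, c 0 = x ∧ deriv c 0 = v ∧ ∃ ε > 0, ContDiffOn ℝ 2 c (Ioo (-ε) ε) ∧
      ∀ t ∈ Ioo (-ε) ε, c t ∈ U ∧ acceleration G c t = 0 := by
  have := FiniteDimensional.complete ℝ V
  obtain ⟨α, hα0, ε₁, hε₁, hα⟩ :=
    (contDiffAt_geodesicField h v).exists_forall_mem_closedBall_exists_eq_forall_mem_Ioo_hasDerivAt₀
      0
  simp only [zero_sub, zero_add] at hα
  have hcont : ContinuousAt (fun t => (α t).1) 0 :=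
    ((hα 0 ⟨by linarith, hε₁⟩).continuousAt).fst
  have hx : (α 0).1 = x := by rw [hα0]
  -- The interval is shortened so that the curve stays in `U` and where `G` is a `C²` metric.
  have hev : ∀ᶠ t in 𝓝 (0 : ℝ), (α t).1 ∈ U ∧ IsMetricAt G (α t).1 := by
    have hU' : ∀ᶠ y in 𝓝 (α 0).1, y ∈ U ∧ IsMetricAt G y := by
      rw [hx]
      exact Filter.Eventually.and hU h.eventually
    exact hcont.eventually hU'
  obtain ⟨ε₂, hε₂, hball⟩ := Metric.eventually_nhds_iff_ball.mp hev
  simp only [Real.ball_eq_Ioo, zero_sub, zero_add] at hball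
  have hε : 0 < min ε₁ ε₂ := lt_min hε₁ hε₂
  have m1 : ∀ t ∈ Ioo (-min ε₁ ε₂) (min ε₁ ε₂), t ∈ Ioo (-ε₁) ε₁ := fun t ht =>
    ⟨by linarith [ht.1, min_le_left ε₁ ε₂], by linarith [ht.2, min_le_left ε₁ ε₂]⟩
  have m2 : ∀ t ∈ Ioo (-min ε₁ ε₂) (min ε₁ ε₂), t ∈ Ioo (-ε₂) ε₂ := fun t ht =>
    ⟨by linarith [ht.1, min_le_right ε₁ ε₂], by linarith [ht.2, min_le_right ε₁ ε₂]⟩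
  have d1 : ∀ t ∈ Ioo (-min ε₁ ε₂) (min ε₁ ε₂), HasDerivAt (fun s => (α s).1) (α t).2 t :=
    fun t ht => (hα t (m1 t ht)).fst
  have d2 : ∀ t ∈ Ioo (-min ε₁ ε₂) (min ε₁ ε₂), HasDerivAt (fun s => (α s).2)
      (- christoffelCLM G (α t).1 (α t).2 (α t).2) t :=
    fun t ht => (hα t (m1 t ht)).snd
  have e1 : ∀ t ∈ Ioo (-min ε₁ ε₂) (min ε₁ ε₂),
      deriv (fun s => (α s).1) =ᶠ[𝓝 t] fun s => (α s).2 := by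
    intro t ht
    filter_upwards [isOpen_Ioo.mem_nhds ht] with s hs using (d1 s hs).deriv
  have z0 : (0 : ℝ) ∈ Ioo (-min ε₁ ε₂) (min ε₁ ε₂) := ⟨by linarith, hε⟩
  refine ⟨fun t => (α t).1, hx, ?_, _, hε, ?_, fun t ht => ⟨(hball t (m2 t ht)).1, ?_⟩⟩
  · rw [(d1 0 z0).deriv, hα0]
  -- The solution is only known to be differentiable; the equation shows that the derivative of the
  -- velocity is continuous, which gives class `C²`.
  · rw [show (2 : WithTop ℕ∞) = 1 + 1 by norm_num, contDiffOn_succ_iff_deriv_of_isOpen isOpen_Ioo]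
    refine ⟨fun t ht => (d1 t ht).differentiableAt.differentiableWithinAt, by simp, ?_⟩
    refine ContDiffOn.congr (f := fun s => (α s).2) ?_ fun t ht => (d1 t ht).deriv
    rw [show (1 : WithTop ℕ∞) = 0 + 1 by norm_num, contDiffOn_succ_iff_deriv_of_isOpen isOpen_Ioo]
    refine ⟨fun t ht => (d2 t ht).differentiableAt.differentiableWithinAt, by simp, ?_⟩
    refine ContDiffOn.congr (f := fun t => - christoffelCLM G (α t).1 (α t).2 (α t).2) ?_
      fun t ht => (d2 t ht).deriv
    rw [contDiffOn_zero]
    intro t ht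
    have c1 := (d1 t ht).continuousAt
    have c2 := (d2 t ht).continuousAt
    have c3 : ContinuousAt (fun s => christoffelCLM G (α s).1) t :=
      ContinuousAt.comp (f := fun s => (α s).1) (g := christoffelCLM G)
        (contDiffAt_christoffelCLM (hball t (m2 t ht)).2).continuousAt c1
    exact ((c3.clm_apply c2).clm_apply c2).neg.continuousWithinAt
  · rw [acceleration, (e1 t ht).deriv_eq, (d1 t ht).deriv, (d2 t ht).deriv, neg_add_cancel]

/-- Both curves with their velocities solve the same first-order system, whose field is locally
Lipschitz, with the same initial value. -/
theorem eventuallyEq_of_acceleration_eq_zero {G : V → V →L[ℝ] V →L[ℝ] ℝ} {c₁ c₂ : ℝ → V} {t₀ : ℝ}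
    (h : IsMetricAt G (c₁ t₀)) (h₁ : ContDiffAt ℝ 2 c₁ t₀) (h₂ : ContDiffAt ℝ 2 c₂ t₀)
    (a₁ : ∀ᶠ t in 𝓝 t₀, acceleration G c₁ t = 0) (a₂ : ∀ᶠ t in 𝓝 t₀, acceleration G c₂ t = 0)
    (h0 : c₁ t₀ = c₂ t₀) (h0' : deriv c₁ t₀ = deriv c₂ t₀) : c₁ =ᶠ[𝓝 t₀] c₂ := by
  obtain ⟨K, s, hs, hL⟩ := (contDiffAt_geodesicField h (deriv c₁ t₀)).exists_lipschitzOnWith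
  have key {c : ℝ → V} (hc : ContDiffAt ℝ 2 c t₀) (hs : s ∈ 𝓝 (c t₀, deriv c t₀))
      (ha : ∀ᶠ t in 𝓝 t₀, acceleration G c t = 0) :
      ∀ᶠ t in 𝓝 t₀, HasDerivAt (fun t => (c t, deriv c t)) (geodesicField G (c t, deriv c t)) t ∧
        (c t, deriv c t) ∈ s := by
    have hdc : ContDiffAt ℝ 1 (deriv c) t₀ := by
      have : deriv c = fun t => fderiv ℝ c t 1 := by ext; simp
      rw [this]
      exact (hc.fderiv_right (by norm_num)).clm_apply contDiffAt_const
    have hct : ContinuousAt (fun t => (c t, deriv c t)) t₀ :=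
      hc.continuousAt.prodMk hdc.continuousAt
    filter_upwards [hc.eventually (by simp), hdc.eventually (by simp), ha,
      hct.eventually hs] with t k1 k2 k3 k4
    refine ⟨(k1.differentiableAt (by norm_num)).hasDerivAt.prodMk ?_, k4⟩
    have := (k2.differentiableAt (by norm_num)).hasDerivAt
    rwa [eq_neg_of_add_eq_zero_left k3] at this
  have := ODE_solution_unique_of_eventually (v := fun _ => geodesicField G) (s := fun _ => s)
    (Filter.Eventually.of_forall fun _ => hL) (key h₁ hs a₁)
    (key h₂ (by rwa [← h0, ← h0']) a₂) (by simp [h0, h0'])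
  filter_upwards [this] with t ht using congrArg Prod.fst ht

/-- An immersion has a local left inverse. -/
theorem IsIsometricAt.exists_leftInverse {G : V → V →L[ℝ] V →L[ℝ] ℝ} {H : W → W →L[ℝ] W →L[ℝ] ℝ}
    {f : V → W} {x : V} (h : IsIsometricAt G H f x) :
    ∃ r : W → V, ContDiffAt ℝ 2 r (f x) ∧ ∀ᶠ y in 𝓝 x, r (f y) = y := by
  have := FiniteDimensional.complete ℝ V
  obtain ⟨L, hL⟩ := LinearMap.exists_leftInverse_of_injective (fderiv ℝ f x : V →ₗ[ℝ] W)
    (LinearMap.ker_eq_bot.mpr h.injective)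
  let L' : W →L[ℝ] V := LinearMap.toContinuousLinearMap L
  -- With `L'` a linear left inverse of `df`, the map `L' ∘ f` is a local diffeomorphism, and `r` is
  -- its local inverse after `L'`.
  have hd : HasFDerivAt (L' ∘ f) ((ContinuousLinearEquiv.refl ℝ V : V ≃L[ℝ] V) : V →L[ℝ] V) x := by
    convert L'.hasFDerivAt.comp x h.differentiableAt.hasFDerivAt using 1
    ext v
    exact (LinearMap.congr_fun hL v).symm
  have hc : ContDiffAt ℝ 2 (L' ∘ f) x := L'.contDiff.contDiffAt.comp x h.contDiffAt_two
  refine ⟨hc.localInverse hd (by norm_num) ∘ L', ?_, ?_⟩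
  · exact (hc.to_localInverse hd (by norm_num)).comp (f x) L'.contDiff.contDiffAt
  · exact (hc.hasStrictFDerivAt' hd (by norm_num)).eventually_left_inverse

end LocalGeometry

/-! ### Geodesics on manifolds and totally geodesic immersions. -/

namespace ManifoldGeometry

open LocalGeometry

variable {V : Type*} [NormedAddCommGroup V] [NormedSpace ℝ V] [FiniteDimensional ℝ V]
variable {M : Type*} [TopologicalSpace M] [ChartedSpace V M] [IsManifold 𝓘(ℝ, V) ∞ M]
variable {W : Type*} [NormedAddCommGroup W] [NormedSpace ℝ W] [FiniteDimensional ℝ W]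
variable {N : Type*} [TopologicalSpace N] [ChartedSpace W N] [IsManifold 𝓘(ℝ, W) ∞ N]
variable {X : Type*} [NormedAddCommGroup X] [NormedSpace ℝ X] [FiniteDimensional ℝ X]
variable {F : Type*} [NormedAddCommGroup F] [InnerProductSpace ℝ F] [FiniteDimensional ℝ F]

/-- The transition maps are local isometries. -/
theorem isIsometricAt_transition (g : SmoothMetric V M) {q r : M} {x : V}
    (hx : x ∈ (chartAt V q).target) (hr : (chartAt V q).symm x ∈ (chartAt V r).source) :
    IsIsometricAt (localMetric g q) (localMetric g r)
      (fun y => chartAt V r ((chartAt V q).symm y)) x := by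
  refine ⟨contDiffAt_chart_comp (by norm_cast) (contMDiffAt_chart_symm (by norm_cast) hx) hr,
    isMetricAt_localMetric g hx, isMetricAt_localMetric g ((chartAt V r).map_source hr), ?_⟩
  have hc := ((chartAt V q).continuousAt_symm hx).eventually ((chartAt V r).open_source.mem_nhds hr)
  filter_upwards [(chartAt V q).open_target.mem_nhds hx, hc] with y hy hy' u v
  rw [localMetric_fderiv g (mdifferentiableAt_chart_symm q hy) hy', localMetric_apply]

theorem secondFundamentalForm_curve (g : SmoothMetric V M) (c : ℝ → M) (t : ℝ) :
    secondFundamentalForm (euclideanMetric ℝ) g c t (1 : ℝ) (1 : ℝ) =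
      acceleration (localMetric g (c t)) (fun s => chartAt V (c t) (c s)) t := by
  change hess (localMetric (euclideanMetric ℝ) t) (localMetric g (c t))
    (fun s => chartAt V (c t) (c s)) t 1 1 = _
  rw [localMetric_euclideanMetric, hess_curve]

/-- The geodesic equation can be written in any chart. -/
theorem acceleration_eq_zero_iff (g : SmoothMetric V M) {c : ℝ → M} {t : ℝ}
    (hc : ContMDiffAt 𝓘(ℝ, ℝ) 𝓘(ℝ, V) 2 c t) {q : M} (hq : c t ∈ (chartAt V q).source) :
    acceleration (localMetric g q) (fun s => chartAt V q (c s)) t = 0 ↔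
      secondFundamentalForm (euclideanMetric ℝ) g c t (1 : ℝ) (1 : ℝ) = (0 : V) := by
  have hl := (chartAt V q).left_inv hq
  have hψ := isIsometricAt_transition g (q := q) (r := c t) ((chartAt V q).map_source hq)
    (by rw [hl]; exact mem_chart_source V (c t))
  have hcq := contDiffAt_chart_comp (by norm_cast) hc hq
  have e : (fun s => chartAt V (c t) (c s)) =ᶠ[𝓝 t]
      (fun y => chartAt V (c t) ((chartAt V q).symm y)) ∘ fun s => chartAt V q (c s) := by
    filter_upwards [eventually_chart_symm_chart hc.continuousAt hq] with s hs
    simp only [Function.comp_apply, hs]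
  -- The transition map is an isometry between spaces of equal dimension: its second fundamental
  -- form is normal to everything, hence zero, and accelerations correspond under its injective
  -- derivative.
  have hsurj : Function.Surjective (fderiv ℝ (fun y => chartAt V (c t)
      ((chartAt V q).symm y)) (chartAt V q (c t)) : V →ₗ[ℝ] V) :=
    LinearMap.injective_iff_surjective.mp hψ.injective
  rw [secondFundamentalForm_curve, acceleration_congr e,
    acceleration_comp (localMetric g q) _ hcq hψ.contDiffAt_two, hψ.hess_eq_zero hsurj, zero_add]
  refine ⟨fun h => by rw [h, map_zero], fun h => hψ.injective (h.trans (map_zero _).symm)⟩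

/-- The velocity of a curve in the chart at a point. -/
theorem mfderiv_curve {c : ℝ → M} {t : ℝ} (hc : ContMDiffAt 𝓘(ℝ, ℝ) 𝓘(ℝ, V) 2 c t) :
    (mfderiv 𝓘(ℝ, ℝ) 𝓘(ℝ, V) c t (1 : ℝ) : V) = deriv (fun s => chartAt V (c t) (c s)) t := by
  have := mfderiv_eq_fderiv_localMap (hc.mdifferentiableAt (by norm_num))
  rw [← fderiv_apply_one_eq_deriv]
  exact DFunLike.congr_fun this (1 : ℝ)

/-- A coordinate geodesic is lifted by the inverse chart at `p`. At later times the geodesic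
equation refers to other preferred charts, which `acceleration_eq_zero_iff` takes care of. -/
theorem exists_geodesic (g : SmoothMetric V M) (p : M) (v : V) :
    ∃ c : ℝ → M, c 0 = p ∧ deriv (fun s => chartAt V p (c s)) 0 = v ∧
      ∃ ε > 0, IsGeodesicOn g c (-ε) ε := by
  obtain ⟨x, hx0, hx0', ε, hε, hx, hgeo⟩ := exists_local_geodesic
    (isMetricAt_localMetric g (chart_mem_target p)) v
    ((chartAt V p).open_target.mem_nhds (chart_mem_target p))
  have z0 : (0 : ℝ) ∈ Ioo (-ε) ε := ⟨by linarith, hε⟩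
  have hcx : ∀ t ∈ Ioo (-ε) ε, (fun s => chartAt V p ((chartAt V p).symm (x s))) =ᶠ[𝓝 t] x := by
    intro t ht
    filter_upwards [isOpen_Ioo.mem_nhds ht] with s hs using (chartAt V p).right_inv (hgeo s hs).1
  have hsm : ∀ t ∈ Ioo (-ε) ε, ContMDiffAt 𝓘(ℝ, ℝ) 𝓘(ℝ, V) 2
      (fun s => (chartAt V p).symm (x s)) t := fun t ht =>
    (contMDiffAt_chart_symm (by norm_cast) (hgeo t ht).1).comp t
      (hx.contDiffAt (isOpen_Ioo.mem_nhds ht)).contMDiffAt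
  refine ⟨fun t => (chartAt V p).symm (x t), ?_, ?_, ε, hε,
    fun t ht => (hsm t ht).contMDiffWithinAt, fun t ht => ?_⟩
  · simp only [hx0, (chartAt V p).left_inv (mem_chart_source V p)]
  · rw [(hcx 0 z0).deriv_eq, hx0']
  · refine (acceleration_eq_zero_iff g (hsm t ht)
      ((chartAt V p).map_target (hgeo t ht).1)).mp ?_
    rw [acceleration_congr (hcx t ht), (hgeo t ht).2]

/-- The second fundamental form of a composition with a curve. -/
theorem secondFundamentalForm_comp_curve {g : SmoothMetric V M} {h : SmoothMetric W N} {φ : M → N}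
    (hφ : IsRiemannianImmersion g h φ) {c : ℝ → M} {t : ℝ}
    (hc : ContMDiffAt 𝓘(ℝ, ℝ) 𝓘(ℝ, V) 2 c t)
    (hgeo : secondFundamentalForm (euclideanMetric ℝ) g c t (1 : ℝ) (1 : ℝ) = (0 : V)) :
    secondFundamentalForm (euclideanMetric ℝ) h (φ ∘ c) t (1 : ℝ) (1 : ℝ) =
      secondFundamentalForm g h φ (c t) (deriv (fun s => chartAt V (c t) (c s)) t)
        (deriv (fun s => chartAt V (c t) (c s)) t) := by
  have hsrc := mem_chart_source V (c t)
  have e : (fun s => chartAt W ((φ ∘ c) t) ((φ ∘ c) s)) =ᶠ[𝓝 t]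
      (localMap φ (c t) : V → W) ∘ fun s => chartAt V (c t) (c s) := by
    filter_upwards [eventually_chart_symm_chart hc.continuousAt hsrc] with s hs
    simp only [localMap, Function.comp_apply, hs]
  rw [secondFundamentalForm_curve] at hgeo
  rw [secondFundamentalForm_curve, acceleration_congr e,
    acceleration_comp (localMetric g (c t)) _ (contDiffAt_chart_comp (by norm_cast) hc hsrc)
      (isIsometricAt_localMap hφ (c t)).contDiffAt_two, hgeo, map_zero, add_zero]
  rfl

section

variable {g : SmoothMetric V M} {h : SmoothMetric W N} {φ : M → N}

theorem contMDiffAt_of_isGeodesicOn {c : ℝ → M} {a b t : ℝ} (hc : IsGeodesicOn g c a b)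
    (ht : t ∈ Ioo a b) : ContMDiffAt 𝓘(ℝ, ℝ) 𝓘(ℝ, V) 2 c t :=
  hc.1.contMDiffAt (isOpen_Ioo.mem_nhds ht)

/-- A riemannian immersion is totally geodesic if and only if its second fundamental form
vanishes. -/
theorem isTotallyGeodesic_iff (hφ : IsRiemannianImmersion g h φ) :
    IsTotallyGeodesic g h φ ↔ ∀ p u v, secondFundamentalForm g h φ p u v = 0 := by
  constructor
  · intro H p u v
    refine hess_eq_zero_of_diagonal (isIsometricAt_localMap hφ p) (fun w => ?_) u v
    obtain ⟨c, hc0, hc0', ε, hε, hc⟩ := exists_geodesic g p w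
    have z0 : (0 : ℝ) ∈ Ioo (-ε) ε := ⟨by linarith, hε⟩
    subst hc0
    have h1 := (H c _ _ hc).2 0 z0
    have h2 := secondFundamentalForm_comp_curve hφ (contMDiffAt_of_isGeodesicOn hc z0) (hc.2 0 z0)
    subst hc0'
    exact h2.symm.trans h1
  · intro H c a b hc
    refine ⟨(hφ.1.of_le (by norm_cast)).comp_contMDiffOn hc.1, fun t ht => ?_⟩
    exact (secondFundamentalForm_comp_curve hφ (contMDiffAt_of_isGeodesicOn hc ht)
      (hc.2 t ht)).trans (H _ _ _)

theorem eventually_acceleration_eq_zero {c : ℝ → M} {a b t : ℝ} (hc : IsGeodesicOn g c a b)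
    (ht : t ∈ Ioo a b) {q : M} (hq : c t ∈ (chartAt V q).source) :
    ∀ᶠ s in 𝓝 t, acceleration (localMetric g q) (fun s => chartAt V q (c s)) s = 0 := by
  have h1 := (contMDiffAt_of_isGeodesicOn hc ht).continuousAt.eventually
    ((chartAt V q).open_source.mem_nhds hq)
  filter_upwards [isOpen_Ioo.mem_nhds ht, h1] with s hs hs'
  exact (acceleration_eq_zero_iff g (contMDiffAt_of_isGeodesicOn hc hs) hs').mpr (hc.2 s hs)

/-- Geodesics with the same velocity at a point coincide near it. -/
theorem eventuallyEq_of_isGeodesicOn {c₁ c₂ : ℝ → M} {a₁ b₁ a₂ b₂ t : ℝ} {q : M}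
    (h₁ : IsGeodesicOn g c₁ a₁ b₁) (h₂ : IsGeodesicOn g c₂ a₂ b₂) (t₁ : t ∈ Ioo a₁ b₁)
    (t₂ : t ∈ Ioo a₂ b₂) (hq : c₁ t ∈ (chartAt V q).source) (h0 : c₁ t = c₂ t)
    (h0' : deriv (fun s => chartAt V q (c₁ s)) t = deriv (fun s => chartAt V q (c₂ s)) t) :
    c₁ =ᶠ[𝓝 t] c₂ := by
  have hq' : c₂ t ∈ (chartAt V q).source := h0 ▸ hq
  have k₁ := contMDiffAt_of_isGeodesicOn h₁ t₁
  have k₂ := contMDiffAt_of_isGeodesicOn h₂ t₂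
  have := eventuallyEq_of_acceleration_eq_zero
    (isMetricAt_localMetric g ((chartAt V q).map_source hq))
    (contDiffAt_chart_comp (by norm_cast) k₁ hq) (contDiffAt_chart_comp (by norm_cast) k₂ hq')
    (eventually_acceleration_eq_zero h₁ t₁ hq) (eventually_acceleration_eq_zero h₂ t₂ hq')
    (by simp only [h0]) h0'
  filter_upwards [this, eventually_chart_symm_chart k₁.continuousAt hq,
    eventually_chart_symm_chart k₂.continuousAt hq'] with s e0 e1 e2
  rw [← e1, ← e2, e0]

theorem deriv_chart_comp (hφ : IsRiemannianImmersion g h φ) {c : ℝ → M} {t : ℝ} {p : M}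
    (hc : ContMDiffAt 𝓘(ℝ, ℝ) 𝓘(ℝ, V) 2 c t) (hp : c t = p) :
    deriv (fun s => chartAt W (φ p) (φ (c s))) t =
      (mfderiv 𝓘(ℝ, V) 𝓘(ℝ, W) φ p (deriv (fun s => chartAt V p (c s)) t : V) : W) := by
  subst hp
  have hsrc := mem_chart_source V (c t)
  have e : (fun s => chartAt W (φ (c t)) (φ (c s))) =ᶠ[𝓝 t]
      (localMap φ (c t) : V → W) ∘ fun s => chartAt V (c t) (c s) := by
    filter_upwards [eventually_chart_symm_chart hc.continuousAt hsrc] with s hs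
    simp only [localMap, Function.comp_apply, hs]
  rw [e.deriv_eq, mfderiv_eq_fderiv_localMap (hφ.1.mdifferentiableAt (by simp))]
  exact fderiv_comp_deriv t (isIsometricAt_localMap hφ (c t)).differentiableAt
    ((contDiffAt_chart_comp (by norm_cast) hc hsrc).differentiableAt (by norm_num))

/-- A riemannian immersion is totally geodesic if and only if its image is. -/
theorem isTotallyGeodesic_iff_hasTotallyGeodesicImage (hφ : IsRiemannianImmersion g h φ) :
    IsTotallyGeodesic g h φ ↔ HasTotallyGeodesicImage (V := V) h φ := by
  constructor
  · intro H p v c a b ha hb hc hc0 hv U hU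
    obtain ⟨σ, hσ0, hσ0', ε, hε, hσ⟩ := exists_geodesic g p v
    have z0 : (0 : ℝ) ∈ Ioo (-ε) ε := ⟨by linarith, hε⟩
    have kσ := contMDiffAt_of_isGeodesicOn hσ z0
    have kc := contMDiffAt_of_isGeodesicOn hc ⟨ha, hb⟩
    have hvel : deriv (fun s => chartAt W (φ p) (c s)) 0 =
        deriv (fun s => chartAt W (φ p) ((φ ∘ σ) s)) 0 := by
      have h1 := deriv_chart_comp hφ kσ hσ0
      rw [hσ0'] at h1
      have h2 := mfderiv_curve kc
      rw [hc0] at h2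
      exact h2.symm.trans (hv.trans h1.symm)
    -- `φ ∘ σ` is a geodesic with the position and velocity of `c` at time `0`, so the two coincide
    -- near `0`.
    have e := eventuallyEq_of_isGeodesicOn (q := φ p) hc (H σ _ _ hσ) ⟨ha, hb⟩ z0
      (by rw [hc0]; exact mem_chart_source W (φ p)) (by simp [hc0, hσ0]) hvel
    have hU' : U ∈ 𝓝 (σ 0) := by rwa [hσ0]
    filter_upwards [e, kσ.continuousAt.eventually hU'] with t ht ht'
    exact ⟨σ t, ht', ht.symm⟩
  · intro H
    rw [isTotallyGeodesic_iff hφ]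
    intro p u v
    have hiso := isIsometricAt_localMap hφ p
    refine hess_eq_zero_of_diagonal hiso (fun w => ?_) u v
    let f : V → W := localMap φ p
    obtain ⟨r, hr, hrf⟩ := hiso.exists_leftInverse
    obtain ⟨c, hc0, hc0', ε, hε, hc⟩ := exists_geodesic h (φ p)
      (mfderiv 𝓘(ℝ, V) 𝓘(ℝ, W) φ p w : W)
    have z0 : (0 : ℝ) ∈ Ioo (-ε) ε := ⟨by linarith, hε⟩
    have kc := contMDiffAt_of_isGeodesicOn hc z0
    have hsrc : c 0 ∈ (chartAt W (φ p)).source := by rw [hc0]; exact mem_chart_source W (φ p)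
    have hvel : (mfderiv 𝓘(ℝ, ℝ) 𝓘(ℝ, W) c 0 (1 : ℝ) : W) =
        (mfderiv 𝓘(ℝ, V) 𝓘(ℝ, W) φ p w : W) := by
      have h2 := mfderiv_curve kc
      rw [hc0] at h2
      exact h2.trans hc0'
    -- The sheet on which `r` undoes `φ`. Applying the hypothesis to this neighbourhood rather than
    -- to the whole manifold excludes points of other sheets of the immersion.
    have hU : {q | q ∈ (chartAt V p).source ∧ r (f (chartAt V p q)) = chartAt V p q} ∈ 𝓝 p :=
      Filter.Eventually.and ((chartAt V p).open_source.mem_nhds (mem_chart_source V p))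
        (((chartAt V p).continuousAt (mem_chart_source V p)).eventually hrf)
    have him := H p w c (-ε) ε (by linarith) hε hc hc0 hvel _ hU
    let y : ℝ → W := fun s => chartAt W (φ p) (c s)
    have hy : ContDiffAt ℝ 2 y 0 := contDiffAt_chart_comp (by norm_cast) kc hsrc
    have hy0 : y 0 = f (chartAt V p p) := by
      simp only [y, f, hc0, localMap_chart]
    have hs : ContDiffAt ℝ 2 (r ∘ y) 0 := by
      refine ContDiffAt.comp 0 ?_ hy
      rw [hy0]; exact hr
    have hs0 : (r ∘ y) 0 = chartAt V p p := by
      rw [Function.comp_apply, hy0]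
      exact hrf.self_of_nhds
    -- Lying in the sheet, the geodesic is the image under `f` of the `C²` curve `r ∘ y` in the
    -- source.
    have hfy : y =ᶠ[𝓝 0] f ∘ (r ∘ y) := by
      filter_upwards [him] with t ht
      obtain ⟨q, ⟨hq1, hq2⟩, hqt⟩ := ht
      have hyt : y t = f (chartAt V p q) := by
        simp only [y, f, localMap, ← hqt, (chartAt V p).left_inv hq1]
      rw [Function.comp_apply, Function.comp_apply, hyt, hq2]
    have hacc : acceleration (localMetric h (φ p)) (f ∘ (r ∘ y)) 0 = 0 := by
      rw [← acceleration_congr hfy]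
      exact (acceleration_eq_zero_iff h kc hsrc).mpr (hc.2 0 z0)
    rw [← hs0] at hiso
    -- Both vectors have the same image under the injective derivative of `f`.
    have hd : deriv (r ∘ y) 0 = w := by
      refine hiso.injective ?_
      have h1 : deriv (f ∘ (r ∘ y)) 0 = fderiv ℝ f ((r ∘ y) 0) (deriv (r ∘ y) 0) :=
        fderiv_comp_deriv 0 hiso.differentiableAt (hs.differentiableAt (by norm_num))
      rw [← hfy.deriv_eq] at h1
      have h3 := mfderiv_eq_fderiv_localMap (p := p) (hφ.1.mdifferentiableAt (by simp))
      rw [hs0] at h1 ⊢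
      refine h1.symm.trans (hc0'.trans ?_)
      exact DFunLike.congr_fun h3 w
    have := hiso.hess_eq_zero_of_acceleration hs hacc
    rw [hd, hs0] at this
    exact this

theorem normSq_eq_zero_of_isTotallyGeodesic (hφ : IsRiemannianImmersion g h φ)
    (H : IsTotallyGeodesic g h φ) (p : M) :
    normSqSecondFundamentalForm g h φ p = 0 ∧ normSqTensionField g h φ p = 0 := by
  have h1 : ∀ u v : V, hess (localMetric g p) (localMetric h (φ p)) (localMap φ p : V → W)
      (chartAt V p p) u v = 0 := (isTotallyGeodesic_iff hφ).mp H p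
  simp [normSqSecondFundamentalForm, normSqHess, normSqTensionField, normSqTension, tension,
    metricTrace, h1]

end

end ManifoldGeometry

theorem mainTheorem8
    {V : Type*} [NormedAddCommGroup V] [NormedSpace ℝ V] [FiniteDimensional ℝ V]
    {Θ : Type*} [TopologicalSpace Θ] [T2Space Θ] [CompactSpace Θ] [ConnectedSpace Θ]
    [ChartedSpace V Θ] [IsManifold 𝓘(ℝ, V) ∞ Θ] (g : SmoothMetric V Θ)
    {W : Type*} [NormedAddCommGroup W] [NormedSpace ℝ W] [FiniteDimensional ℝ W]
    {Λ : Type*} [TopologicalSpace Λ] [T2Space Λ] [CompactSpace Λ] [ConnectedSpace Λ]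
    [ChartedSpace W Λ] [IsManifold 𝓘(ℝ, W) ∞ Λ] (h : SmoothMetric W Λ)
    {F : Type*} [NormedAddCommGroup F] [InnerProductSpace ℝ F] [FiniteDimensional ℝ F]
    (ι : Θ → F) (hι : IsEmbedding ι) (hι' : IsRiemannianImmersion g (euclideanMetric F) ι)
    (γ : Θ → Λ) (hγ : IsRiemannianImmersion g h γ) :
    (∀ u : Θ → ℝ, ContMDiff 𝓘(ℝ, V) 𝓘(ℝ, ℝ) ∞ u →
      ∀ θ, subLaplacian g h γ u θ = laplacian g u θ) ∧
    (∀ θ, curvatureTerm g h ι γ θ =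
      5 / 3 * normSqSecondFundamentalForm g (euclideanMetric F) ι θ
        - 2 / 3 * normSqTensionField g (euclideanMetric F) ι θ
        - 1 / 6 * normSqSecondFundamentalForm g h γ θ
        - 1 / 3 * normSqTensionField g h γ θ) ∧
    (IsTotallyGeodesic g h γ ↔ ∀ θ u v, secondFundamentalForm g h γ θ u v = 0) ∧
    (IsTotallyGeodesic g h γ ↔ HasTotallyGeodesicImage (V := V) h γ) ∧
    (IsTotallyGeodesic g h γ → ∀ θ, curvatureTerm g h ι γ θ =
      5 / 3 * normSqSecondFundamentalForm g (euclideanMetric F) ι θ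
        - 2 / 3 * normSqTensionField g (euclideanMetric F) ι θ) := by
  have hκ := ManifoldGeometry.curvatureTerm_eq hι hι' hγ
  refine ⟨fun u hu θ => ManifoldGeometry.subLaplacian_eq_laplacian hγ hu θ, hκ,
    ManifoldGeometry.isTotallyGeodesic_iff hγ,
    ManifoldGeometry.isTotallyGeodesic_iff_hasTotallyGeodesicImage hγ, fun H θ => ?_⟩
  obtain ⟨h1, h2⟩ := ManifoldGeometry.normSq_eq_zero_of_isTotallyGeodesic hγ H θ
  rw [hκ, h1, h2]
  ring
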